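/- Let $X\subseteq\mathbb R^d$ ($d\ge 1$) be closed and convex, let $\xi\sim P$ be a random element of a space $\Xi$, and let $F(\cdot\,;\xi):\mathbb R^d\to\mathbb R$ be $L_0$-Lipschitz with respect to the $\ell_2$-norm for $P$-almost every $\xi$, where $L_0>0$. Suppose that $f(x)=\mathbb E_{\xi\sim P}[F(x;\xi)]$ is finite and convex on $\mathbb R^d$, that $\varphi:X\to\mathbb R$ is closed and convex, and that $\psi:X\to[0,\infty)$ is strongly convex with modulus $1$ with respect to the $\ell_2$-norm. Let $m\ge 1$ and $R>0$. For a function $h:\mathbb R^d\to\mathbb R$ let $\partial h(x)=\{v: h(w)\ge h(x)+\langle v,w-x\rangle\ \text{for all } w\in\mathbb R^d\}$. Set $\theta_0=1$, $\theta_{t+1}=2/\bigl(1+\sqrt{1+4/\theta_t^2}\bigr)$, $u=Rd^{-1/4}$, $u_t=\theta_t u$, $L_t=L_0/u_t$ and $\eta_t=L_0\sqrt{t+1}/(R\sqrt m)$. Let the pairs $(Z_{i,t},\xi_{i,t})$, $1\le i\le m$, $t\ge 0$, be i.i.d. with $Z_{i,t}\sim N(0,I_d)$ and $\xi_{i,t}\sim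 P$ independent of each other. Starting from arbitrary deterministic $x_0,z_0\in X$, let the iterates satisfy, for $t=0,1,2,\dots$, $$y_t=(1-\theta_t)x_t+\theta_t z_t,\qquad g_{i,t}\in\partial F(\cdot\,;\xi_{i,t})\,(y_t+u_tZ_{i,t})\ \text{almost surely }(1\le i\le m),\qquad g_t=\frac1m\sum_{i=1}^m g_{i,t},$$ $$z_{t+1}\in\operatorname*{argmin}_{x\in X}\Bigl\{\sum_{\tau=0}^t\frac1{\theta_\tau}\langle g_\tau,x\rangle+\sum_{\tau=0}^t\frac1{\theta_\tau}\varphi(x)+L_{t+1}\psi(x)+\frac{\eta_{t+1}}{\theta_{t+1}}\psi(x)\Bigr\},\qquad x_{t+1}=(1-\theta_t)x_t+\theta_t z_{t+1}.$$ Then for every $T\ge 4$ and every $x^*\in X$ with $\psi(x^*)\le R^2$, the random variable $f(x_T)+\varphi(x_T)$ is integrable and $$\mathbb E\bigl[f(x_T)+\varphi(x_T)\bigr]-\bigl[f(x^*)+\varphi(x^*)\bigr]\le\frac{10L_0Rd^{1/4}}{T}+\frac{5L_0R}{\sqrt{Tm}}.$$ -/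

import Mathlib

open MeasureTheory ProbabilityTheory

noncomputable section

namespace RandomizedSmoothing

/-- `v` is a subgradient of `h : ℝᵈ → ℝ` at `x`; the set of all subgradients is `∂h(x)`. -/
def subdifferential {d : ℕ} (h : EuclideanSpace ℝ (Fin d) → ℝ) (x : EuclideanSpace ℝ (Fin d)) :
    Set (EuclideanSpace ℝ (Fin d)) :=
  {v | ∀ w, h x + inner ℝ v (w - x) ≤ h w}

/-- The objective `f(x) = 𝔼 F(x; ξ)`, `ξ ∼ P`. -/
def expectedObjective {d : ℕ} {Ξ : Type*} [MeasurableSpace Ξ]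
    (F : EuclideanSpace ℝ (Fin d) → Ξ → ℝ) (P : Measure Ξ) (x : EuclideanSpace ℝ (Fin d)) : ℝ :=
  ∫ s, F x s ∂P

/-- The averaging sequence `θ₀ = 1`, `θₜ = 2 / (1 + √(1 + 4 / θₜ₋₁²))`. -/
def theta : ℕ → ℝ
  | 0 => 1
  | t + 1 => 2 / (1 + √(1 + 4 / theta t ^ 2))

/-- The samples: over all times `t` and `i = 1, …, m` the pairs `(Z_{i,t}, ξ_{i,t})` are i.i.d. with
law `N(0, I) ⊗ P`. -/
structure IsGaussianSampling {d m : ℕ} {Ω Ξ : Type*} [MeasurableSpace Ω] [MeasurableSpace Ξ]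
    (μ : Measure Ω) (P : Measure Ξ) (Z : ℕ → Fin m → Ω → EuclideanSpace ℝ (Fin d))
    (ξ : ℕ → Fin m → Ω → Ξ) : Prop where
  hasLaw : ∀ t i, HasLaw (fun ω => (Z t i ω, ξ t i ω))
    ((stdGaussian (EuclideanSpace ℝ (Fin d))).prod P) μ
  iIndepFun : iIndepFun (fun (p : ℕ × Fin m) ω => (Z p.1 p.2 ω, ξ p.1 p.2 ω)) μ

/-- The averaged stochastic gradient `gₜ = (1/m) ∑ᵢ g_{i,t}`. -/
def averageGradient {d m : ℕ} {Ω : Type*} (g : ℕ → Fin m → Ω → EuclideanSpace ℝ (Fin d))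
    (t : ℕ) (ω : Ω) : EuclideanSpace ℝ (Fin d) :=
  (1 / (m : ℝ)) • ∑ i, g t i ω

/-- The function minimized over `X` at the end of iteration `t`, for given averaged gradients `G`:
`∑_{τ ≤ t} ⟨G_τ, x⟩ / θ_τ + ∑_{τ ≤ t} φ(x) / θ_τ + L_{t+1} ψ(x) + (η_{t+1} / θ_{t+1}) ψ(x)`. -/
def dualAveragingObjective {d : ℕ} (φ ψ : EuclideanSpace ℝ (Fin d) → ℝ) (L η : ℕ → ℝ)
    (G : ℕ → EuclideanSpace ℝ (Fin d)) (t : ℕ) (x : EuclideanSpace ℝ (Fin d)) : ℝ :=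
  ∑ τ ∈ Finset.range (t + 1), 1 / theta τ * inner ℝ (G τ) x
    + ∑ τ ∈ Finset.range (t + 1), 1 / theta τ * φ x
    + L (t + 1) * ψ x + η (t + 1) / theta (t + 1) * ψ x

/-- `(x, y, z)` is a run of the accelerated randomized-smoothing dual averaging method on the set
`X` with regularizer `φ`, proximal function `ψ`, smoothing sequence `u`, step-size sequences `L`, `η`,
started at `x₀, z₀`, where `g t i` is the answer of the stochastic subgradient oracle to the `i`-th
query `(y_t + u_t Z_{i,t}, ξ_{i,t})` of iteration `t`. -/
structure IsRun {d m : ℕ} {Ω Ξ : Type*} [MeasurableSpace Ω] (μ : Measure Ω)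
    (F : EuclideanSpace ℝ (Fin d) → Ξ → ℝ) (X : Set (EuclideanSpace ℝ (Fin d)))
    (φ ψ : EuclideanSpace ℝ (Fin d) → ℝ) (u L η : ℕ → ℝ) (x₀ z₀ : EuclideanSpace ℝ (Fin d))
    (Z : ℕ → Fin m → Ω → EuclideanSpace ℝ (Fin d)) (ξ : ℕ → Fin m → Ω → Ξ)
    (g : ℕ → Fin m → Ω → EuclideanSpace ℝ (Fin d))
    (x y z : ℕ → Ω → EuclideanSpace ℝ (Fin d)) : Prop where
  x_zero : ∀ ω, x 0 ω = x₀
  z_zero : ∀ ω, z 0 ω = z₀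
  y_eq : ∀ t ω, y t ω = (1 - theta t) • x t ω + theta t • z t ω
  oracle : ∀ t i, ∀ᵐ ω ∂μ,
    g t i ω ∈ subdifferential (fun w => F w (ξ t i ω)) (y t ω + u t • Z t i ω)
  z_mem : ∀ t ω, z (t + 1) ω ∈ X
  z_min : ∀ t ω, IsMinOn
    (dualAveragingObjective φ ψ L η (fun τ => averageGradient g τ ω) t) X (z (t + 1) ω)
  x_succ : ∀ t ω, x (t + 1) ω = (1 - theta t) • x t ω + theta t • z (t + 1) ω

end RandomizedSmoothing

end

/-! The method is accelerated dual averaging applied to the Gaussian smoothings f_u(y) = 𝔼 f(y +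
uZ), with u = u_t decreasing. Three facts about f_u carry the proof. Convexity and the symmetry of Z
give f ≤ f_{u'} ≤ f_u for 0 ≤ u' ≤ u, while f_u ≤ f + L₀ u √d (`gaussianSmoothing_mono`,
`gaussianSmoothing_le`). The descent lemma holds for f_u with the dimension-free constant L₀/u: by
Cameron–Martin and Cauchy–Schwarz, translating Z by a small a changes the mean of a bounded quantity
by about ‖a‖ times its bound (`IsGradientSelection.gaussianSmoothing_add_le`). Finally, the oracle
gives unbiased estimates, bounded by L₀, of a gradient of f_u, so the average of m of them has error
with second moment at most L₀²/m.

The deterministic core is `IsPerturbedPath.objective_le`. Since ∑_{τ ≤ t} 1/θ_τ = 1/θ_t², estimates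
weighted by 1/θ_t² telescope; quadratic growth at the dual averaging minimizer pays for the
curvature L_t and for Young's inequality with parameter η_t. Passing from one smoothing to the next
costs nothing, and the bias at x* is L₀ R d^{1/4} θ_t, which the weight 1/θ_t turns into a constant
per step. As z₀ need not minimize ψ, the first step is bounded by Lipschitz continuity alone, which
costs 5 L₀ R. In expectation the linear noise vanishes and the quadratic noise leaves L₀²/(2 m η_t)
per unit weight; dividing by 1/θ_{T-1}² ≥ (T+1)²/4 gives the rate.

The probabilistic difficulty is that neither convexity of F(·; s) nor measurability of g and z is
given. The oracle nevertheless has no freedom. A Lipschitz function is almost everywhere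
differentiable along the axes, which determines its subgradients there; they exist almost everywhere
because the first query is centred at the deterministic point y₀ = z₀ and Gaussian and Lebesgue null
sets coincide (`exists_gradient_selection`). The minimizer depends continuously on the accumulated
gradient (`exists_continuous_argmin`). So all iterates are, almost surely, bounded functions of the
past samples (`IsRun.adapted`), even for unbounded X. -/

noncomputable section

namespace RandomizedSmoothing

/-! ### Translations of the standard Gaussian measure. -/

section Gaussian

variable {E : Type*} [NormedAddCommGroup E] [InnerProductSpace ℝ E] [FiniteDimensional ℝ E]
  [MeasurableSpace E] [BorelSpace E]

lemma map_inner_stdGaussian (v : E) :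
    (stdGaussian E).map (fun x => inner ℝ v x) = gaussianReal 0 (‖v‖ ^ 2).toNNReal := by
  have h := IsGaussian.map_eq_gaussianReal (μ := stdGaussian E) (innerSL ℝ v)
  rw [integral_strongDual_stdGaussian, variance_dual_stdGaussian, innerSL_apply_norm] at h
  exact h

lemma mgf_inner_stdGaussian (v : E) (t : ℝ) :
    mgf (fun x => inner ℝ v x) (stdGaussian E) t = Real.exp (‖v‖ ^ 2 * t ^ 2 / 2) := by
  rw [mgf_gaussianReal (map_inner_stdGaussian v), Real.coe_toNNReal _ (by positivity)]
  simp

lemma integral_exp_inner_stdGaussian (v : E) :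
    ∫ x, Real.exp (inner ℝ v x) ∂(stdGaussian E) = Real.exp (‖v‖ ^ 2 / 2) := by
  simpa [mgf] using mgf_inner_stdGaussian v 1

/-- The integral of a non-integrable function is 0 by convention, whereas this one is positive. -/
lemma integrable_exp_inner_stdGaussian (v : E) :
    Integrable (fun x => Real.exp (inner ℝ v x)) (stdGaussian E) := by
  by_contra h
  have h1 := integral_exp_inner_stdGaussian v
  rw [integral_undef h] at h1
  exact (Real.exp_pos _).ne h1

/-- The Cameron–Martin formula: exponentially tilting the standard Gaussian measure translates it. -/
lemma tilted_inner_stdGaussian (a : E) :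
    (stdGaussian E).tilted (fun x => inner ℝ a x) = (stdGaussian E).map (fun x => x + a) := by
  have hprob := isProbabilityMeasure_tilted (integrable_exp_inner_stdGaussian a)
  have hprob' : IsProbabilityMeasure ((stdGaussian E).map (fun x => x + a)) :=
    Measure.isProbabilityMeasure_map (by fun_prop)
  refine Measure.ext_of_charFunDual (funext fun ℓ => ?_)
  rw [charFunDual_eq_charFun_map_one, charFunDual_eq_charFun_map_one]
  congr 1
  obtain ⟨t, rfl⟩ : ∃ t, innerSL ℝ t = ℓ :=
    ⟨(InnerProductSpace.toDual ℝ E).symm ℓ, by ext; simp⟩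
  have hmgf : ∀ s, mgf (fun x => inner ℝ t x) ((stdGaussian E).tilted (fun x => inner ℝ a x)) s
      = Real.exp (‖t‖ ^ 2 * s ^ 2 / 2 + s * inner ℝ t a) := by
    intro s
    have hfun : ∀ x, s * inner ℝ t x = inner ℝ (s • t) x := fun x => by
      rw [real_inner_smul_left]
    have hfun2 : ∀ x, ((fun x => inner ℝ a x) + fun x => inner ℝ (s • t) x) x
      = inner ℝ (a + s • t) x := fun x => by simp [inner_add_left]
    simp_rw [mgf, hfun]
    rw [integral_exp_tilted]
    simp_rw [hfun2]
    rw [integral_exp_inner_stdGaussian, integral_exp_inner_stdGaussian, ← Real.exp_sub,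
      norm_add_sq_real, real_inner_smul_right, norm_smul, mul_pow, Real.norm_eq_abs, sq_abs,
      real_inner_smul_left, real_inner_comm a t]
    ring_nf
  have hmgf' : ∀ s, mgf (fun x => inner ℝ t x) ((stdGaussian E).map (fun x => x + a)) s
      = Real.exp (‖t‖ ^ 2 * s ^ 2 / 2 + s * inner ℝ t a) := by
    intro s
    rw [mgf, integral_map (by fun_prop) (by fun_prop), Real.exp_add, ← mgf_inner_stdGaussian t s,
      mgf, ← integral_mul_const]
    simp_rw [inner_add_right, mul_add, Real.exp_add]
  refine Measure.ext_of_complexMGF_eq (X := fun x => inner ℝ t x) (Y := fun x => inner ℝ t x)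
    (by fun_prop) (by fun_prop) (funext fun w => ?_)
  -- Agreement of the real moment generating functions extends to the strip over the interior of the
  -- set where they are finite; that set is all of ℝ, because a positive value rules out the default
  -- 0.
  refine eqOn_complexMGF_of_mgf (funext fun s => by rw [hmgf, hmgf']) ?_
  have huniv : integrableExpSet (fun x => inner ℝ t x)
      ((stdGaussian E).tilted (fun x => inner ℝ a x)) = Set.univ := by
    refine Set.eq_univ_of_forall fun s => ?_
    rw [integrableExpSet, Set.mem_ofPred_eq, ← mgf_pos_iff, hmgf]
    positivity
  simp [huniv]

/-- A change of variables `z ↦ z + a` under a Gaussian integral. -/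
lemma integral_add_stdGaussian {G : Type*} [NormedAddCommGroup G] [NormedSpace ℝ G] (h : E → G)
    (a : E) :
    ∫ z, h (z + a) ∂(stdGaussian E)
      = ∫ z, Real.exp (inner ℝ a z - ‖a‖ ^ 2 / 2) • h z ∂(stdGaussian E) := by
  have hme : MeasurableEmbedding (fun x : E => x + a) := measurableEmbedding_addRight a
  rw [← hme.integral_map, ← tilted_inner_stdGaussian, integral_tilted,
    integral_exp_inner_stdGaussian]
  simp_rw [Real.exp_sub]

lemma ae_add_stdGaussian_iff {p : E → Prop} (a : E) :
    (∀ᵐ z ∂(stdGaussian E), p (z + a)) ↔ ∀ᵐ z ∂(stdGaussian E), p z := by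
  have hme : MeasurableEmbedding (fun x : E => x + a) := measurableEmbedding_addRight a
  rw [← hme.ae_map_iff, ← tilted_inner_stdGaussian]
  exact ⟨fun h => absolutelyContinuous_tilted (integrable_exp_inner_stdGaussian a) h,
    fun h => tilted_absolutelyContinuous _ _ h⟩

/-- The standard Gaussian measure and the Lebesgue measure have the same null sets. -/
lemma stdGaussian_null_iff {A : Set E} (hA : MeasurableSet A) :
    stdGaussian E A = 0 ↔ (volume : Measure E) A = 0 := by
  -- Slice the set {(z, x) | z + x ∈ A} under Gaussian ⊗ Lebesgue in both ways: each z-slice has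
  -- volume that of A, and each x-slice is Gaussian-null exactly when A is, by Cameron–Martin.
  have hmeas : MeasurableSet {p : E × E | p.1 + p.2 ∈ A} := (measurable_fst.add measurable_snd) hA
  have hvol : ∀ z : E, volume {x : E | z + x ∈ A} = volume A := fun z =>
    measure_preimage_add volume z A
  have hshift : ∀ x : E, stdGaussian E {z | z + x ∈ A} = 0 ↔ stdGaussian E A = 0 := fun x => by
    have := ae_add_stdGaussian_iff (p := fun z => z ∉ A) x
    simpa [ae_iff] using this
  have h1 : (stdGaussian E).prod volume {p : E × E | p.1 + p.2 ∈ A} = 0 ↔ volume A = 0 := by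
    rw [Measure.measure_prod_null hmeas]
    have : (fun z : E => volume (Prod.mk z ⁻¹' {p : E × E | p.1 + p.2 ∈ A}))
        = fun _ => volume A := funext hvol
    rw [this]
    constructor
    · intro h
      exact h.exists.choose_spec
    · intro h
      simp only [h]
      rfl
  have h2 : (stdGaussian E).prod volume {p : E × E | p.1 + p.2 ∈ A} = 0 ↔ stdGaussian E A = 0 := by
    rw [Measure.prod_apply_symm hmeas, lintegral_eq_zero_iff (measurable_measure_prodMk_right hmeas)]
    constructor
    · intro h
      obtain ⟨x, hx⟩ := h.exists
      exact (hshift x).1 hx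
    · intro h
      exact Filter.Eventually.of_forall fun x => (hshift x).2 h
  rw [← h1, h2]

/-- An affine image of the standard Gaussian measure has the null sets of the Lebesgue measure. -/
lemma ae_add_smul_stdGaussian_iff {p : E → Prop} (hp : MeasurableSet {w | p w}) (y : E) {u : ℝ}
    (hu : u ≠ 0) :
    (∀ᵐ z ∂(stdGaussian E), p (y + u • z)) ↔ ∀ᵐ w ∂(volume : Measure E), p w := by
  have hm : MeasurableSet {z : E | ¬ p (y + u • z)} :=
    (measurable_const.add (measurable_id.const_smul u)) hp.compl
  rw [ae_iff, ae_iff, stdGaussian_null_iff hm]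
  have h1 : {z : E | ¬ p (y + u • z)} = (fun z => u • z) ⁻¹' ((fun z => y + z) ⁻¹' {w | ¬ p w}) := rfl
  rw [h1, Measure.addHaar_preimage_smul volume hu, measure_preimage_add]
  simp [hu]

omit [FiniteDimensional ℝ E] [MeasurableSpace E] [BorelSpace E] in
lemma sq_exp_inner_sub_one_eq (a z : E) :
    (Real.exp (inner ℝ a z - ‖a‖ ^ 2 / 2) - 1) ^ 2
      = Real.exp (-‖a‖ ^ 2) * Real.exp (inner ℝ ((2 : ℝ) • a) z)
        - (2 * Real.exp (-(‖a‖ ^ 2 / 2)) * Real.exp (inner ℝ a z) - 1) := by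
  rw [real_inner_smul_left, two_mul, Real.exp_add, Real.exp_sub, Real.exp_neg, Real.exp_neg]
  have : Real.exp (‖a‖ ^ 2) = Real.exp (‖a‖ ^ 2 / 2) * Real.exp (‖a‖ ^ 2 / 2) := by
    rw [← Real.exp_add]; ring_nf
  rw [this]
  field_simp
  ring

lemma integrable_sq_exp_inner_sub_one (a : E) :
    Integrable (fun z => (Real.exp (inner ℝ a z - ‖a‖ ^ 2 / 2) - 1) ^ 2) (stdGaussian E) := by
  simp_rw [sq_exp_inner_sub_one_eq]
  exact ((integrable_exp_inner_stdGaussian _).const_mul _).sub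
      (((integrable_exp_inner_stdGaussian _).const_mul _).sub (integrable_const _))

/-- This is the χ²-divergence between the Gaussian translated by a and the centred one. -/
lemma integral_sq_exp_inner_sub_one (a : E) :
    ∫ z, (Real.exp (inner ℝ a z - ‖a‖ ^ 2 / 2) - 1) ^ 2 ∂(stdGaussian E)
      = Real.exp (‖a‖ ^ 2) - 1 := by
  have hint : Integrable (fun z => 2 * Real.exp (-(‖a‖ ^ 2 / 2)) * Real.exp (inner ℝ a z) - 1)
      (stdGaussian E) :=
    ((integrable_exp_inner_stdGaussian _).const_mul _).sub (integrable_const _)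
  simp_rw [sq_exp_inner_sub_one_eq]
  rw [integral_sub ((integrable_exp_inner_stdGaussian _).const_mul _) hint,
    integral_sub ((integrable_exp_inner_stdGaussian _).const_mul _) (integrable_const _),
    integral_const_mul, integral_const_mul,
    integral_exp_inner_stdGaussian, integral_exp_inner_stdGaussian, norm_smul, mul_assoc,
    ← Real.exp_add, ← Real.exp_add]
  simp only [Real.norm_ofNat, integral_const, probReal_univ, smul_eq_mul, mul_one]
  rw [neg_add_cancel, Real.exp_zero]
  ring_nf

lemma memLp_exp_inner_sub_one (a : E) :
    MemLp (fun z => |Real.exp (inner ℝ a z - ‖a‖ ^ 2 / 2) - 1|) 2 (stdGaussian E) := by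
  rw [memLp_two_iff_integrable_sq (by fun_prop)]
  simpa only [sq_abs] using integrable_sq_exp_inner_sub_one a

/-- Cauchy–Schwarz, in the form that a variance is nonnegative. -/
lemma integral_abs_exp_inner_sub_one_le (a : E) :
    ∫ z, |Real.exp (inner ℝ a z - ‖a‖ ^ 2 / 2) - 1| ∂(stdGaussian E)
      ≤ √(Real.exp (‖a‖ ^ 2) - 1) := by
  have h := variance_eq_sub (memLp_exp_inner_sub_one a)
  have h0 := variance_nonneg
    (fun z => |Real.exp (inner ℝ a z - ‖a‖ ^ 2 / 2) - 1|) (stdGaussian E)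
  simp only [Pi.pow_apply, sq_abs, integral_sq_exp_inner_sub_one] at h
  exact Real.le_sqrt_of_sq_le (by linarith)

/-- Translating a Gaussian argument by `a` changes the integral of a function with values in
`[-C, C]` by at most `C √(exp ‖a‖² - 1)`. -/
lemma integral_add_stdGaussian_sub_le {h : E → ℝ} {C : ℝ}
    (hm : AEStronglyMeasurable h (stdGaussian E)) (hC : ∀ᵐ z ∂(stdGaussian E), |h z| ≤ C) (a : E) :
    ∫ z, h (z + a) ∂(stdGaussian E) - ∫ z, h z ∂(stdGaussian E)
      ≤ C * √(Real.exp (‖a‖ ^ 2) - 1) := by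
  have hint : Integrable h (stdGaussian E) :=
    Integrable.of_bound hm C (by simpa using hC)
  have hexp : Integrable (fun z => Real.exp (inner ℝ a z - ‖a‖ ^ 2 / 2)) (stdGaussian E) := by
    simp_rw [Real.exp_sub]
    exact (integrable_exp_inner_stdGaussian a).div_const _
  have habs : Integrable (fun z => |Real.exp (inner ℝ a z - ‖a‖ ^ 2 / 2) - 1|) (stdGaussian E) :=
    (memLp_exp_inner_sub_one a).integrable (by norm_num)
  have hC0 : 0 ≤ C := by
    obtain ⟨z, hz⟩ := hC.exists
    exact (abs_nonneg _).trans hz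
  have hprod : Integrable (fun z => Real.exp (inner ℝ a z - ‖a‖ ^ 2 / 2) • h z)
      (stdGaussian E) := by
    simpa only [smul_eq_mul] using hexp.mul_bdd (c := C) hm (by simpa using hC)
  rw [integral_add_stdGaussian, ← integral_sub hprod hint]
  calc ∫ z, (Real.exp (inner ℝ a z - ‖a‖ ^ 2 / 2) • h z - h z) ∂(stdGaussian E)
      ≤ ∫ z, C * |Real.exp (inner ℝ a z - ‖a‖ ^ 2 / 2) - 1| ∂(stdGaussian E) := by
        refine integral_mono_ae (hprod.sub hint) (habs.const_mul C) ?_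
        filter_upwards [hC] with z hz
        calc Real.exp (inner ℝ a z - ‖a‖ ^ 2 / 2) • h z - h z
            = (Real.exp (inner ℝ a z - ‖a‖ ^ 2 / 2) - 1) * h z := by rw [smul_eq_mul]; ring
          _ ≤ |(Real.exp (inner ℝ a z - ‖a‖ ^ 2 / 2) - 1) * h z| := le_abs_self _
          _ ≤ C * |Real.exp (inner ℝ a z - ‖a‖ ^ 2 / 2) - 1| := by
            rw [abs_mul, mul_comm]
            gcongr
    _ ≤ C * √(Real.exp (‖a‖ ^ 2) - 1) := by
        rw [integral_const_mul]
        gcongr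
        exact integral_abs_exp_inner_sub_one_le a

end Gaussian

/-! ### Almost everywhere unique subgradients and their measurable selection. -/

section GradientSelection

open Filter Topology

variable {d : ℕ} {Ξ : Type*} [MeasurableSpace Ξ]

lemma ae_affine_prod_iff {P : Measure Ξ} [SFinite P] {A : Set (EuclideanSpace ℝ (Fin d) × Ξ)}
    (hA : MeasurableSet A) (y : EuclideanSpace ℝ (Fin d)) {u : ℝ} (hu : u ≠ 0) :
    (∀ᵐ p ∂(stdGaussian (EuclideanSpace ℝ (Fin d))).prod P, (y + u • p.1, p.2) ∈ A)
      ↔ ∀ᵐ s ∂P, ∀ᵐ w ∂(volume : Measure (EuclideanSpace ℝ (Fin d))), (w, s) ∈ A := by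
  have hm : MeasurableSet {p : EuclideanSpace ℝ (Fin d) × Ξ | (y + u • p.1, p.2) ∈ A} :=
    (by fun_prop : Measurable fun p : EuclideanSpace ℝ (Fin d) × Ξ => (y + u • p.1, p.2)) hA
  rw [Measure.ae_prod_iff_ae_ae hm, Measure.ae_ae_comm hm]
  refine eventually_congr (Eventually.of_forall fun s => ?_)
  exact ae_add_smul_stdGaussian_iff (p := fun w => (w, s) ∈ A) (measurable_prodMk_right hA) y hu

/-- The difference quotient of `F · s` at `w` in direction `j` with increment `t`. -/
def differenceQuotient (F : EuclideanSpace ℝ (Fin d) → Ξ → ℝ) (j : Fin d) (t : ℝ)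
    (p : EuclideanSpace ℝ (Fin d) × Ξ) : ℝ :=
  t⁻¹ * (F (p.1 + t • EuclideanSpace.single j 1) p.2 - F p.1 p.2)

/-- A jointly measurable candidate for the gradient of `F · s` at `w`. -/
def measurableGradient (F : EuclideanSpace ℝ (Fin d) → Ξ → ℝ) (w : EuclideanSpace ℝ (Fin d))
    (s : Ξ) : EuclideanSpace ℝ (Fin d) :=
  WithLp.toLp 2 fun j =>
    limsup (fun n : ℕ => differenceQuotient F j (1 / ((n : ℝ) + 1)) (w, s)) atTop

/-- The pairs `(w, s)` at which the two one-sided difference quotients of `F · s` merge. -/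
def mergingSet (F : EuclideanSpace ℝ (Fin d) → Ξ → ℝ) : Set (EuclideanSpace ℝ (Fin d) × Ξ) :=
  {p | ∀ j, Tendsto (fun n : ℕ => differenceQuotient F j (1 / ((n : ℝ) + 1)) p
    - differenceQuotient F j (-(1 / ((n : ℝ) + 1))) p) atTop (𝓝 0)}

lemma measurable_differenceQuotient {F : EuclideanSpace ℝ (Fin d) → Ξ → ℝ}
    (hF : Measurable (Function.uncurry F)) (j : Fin d) (t : ℝ) :
    Measurable (differenceQuotient F j t) := by
  have h1 : Measurable fun p : EuclideanSpace ℝ (Fin d) × Ξ =>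
      F (p.1 + t • EuclideanSpace.single j 1) p.2 :=
    hF.comp (by fun_prop :
      Measurable fun p : EuclideanSpace ℝ (Fin d) × Ξ => (p.1 + t • EuclideanSpace.single j 1, p.2))
  exact (h1.sub hF).const_mul _

lemma measurable_measurableGradient {F : EuclideanSpace ℝ (Fin d) → Ξ → ℝ}
    (hF : Measurable (Function.uncurry F)) :
    Measurable (Function.uncurry (measurableGradient F)) := by
  refine (WithLp.measurable_toLp 2 _).comp (measurable_pi_lambda _ fun j => ?_)
  exact Measurable.limsup fun n => measurable_differenceQuotient hF j _

lemma measurableSet_mergingSet {F : EuclideanSpace ℝ (Fin d) → Ξ → ℝ}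
    (hF : Measurable (Function.uncurry F)) : MeasurableSet (mergingSet F) := by
  have : mergingSet F = ⋂ j, {p | Tendsto (fun n : ℕ =>
      differenceQuotient F j (1 / ((n : ℝ) + 1)) p
        - differenceQuotient F j (-(1 / ((n : ℝ) + 1))) p) atTop (𝓝 0)} := by
    ext p
    simp [mergingSet]
  rw [this]
  exact MeasurableSet.iInter fun j => measurableSet_tendsto _ fun n =>
    (measurable_differenceQuotient hF j _).sub (measurable_differenceQuotient hF j _)

-- Each coordinate of a subgradient lies between the backward and the forward difference quotient.
-- Where these merge, the forward quotient converges to that coordinate, so the limsup equals it.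
omit [MeasurableSpace Ξ] in
lemma eq_measurableGradient_of_mem_subdifferential {F : EuclideanSpace ℝ (Fin d) → Ξ → ℝ}
    {w v : EuclideanSpace ℝ (Fin d)} {s : Ξ} (hm : (w, s) ∈ mergingSet F)
    (hv : v ∈ subdifferential (fun w => F w s) w) : v = measurableGradient F w s := by
  ext j
  have hstep : ∀ t : ℝ, t * v j ≤ F (w + t • EuclideanSpace.single j 1) s - F w s := fun t => by
    have h := hv (w + t • EuclideanSpace.single j 1)
    rw [add_sub_cancel_left, real_inner_smul_right, real_inner_comm,
      EuclideanSpace.inner_single_left] at h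
    simp only [map_one, one_mul] at h
    linarith
  have hup : ∀ n : ℕ, v j ≤ differenceQuotient F j (1 / ((n : ℝ) + 1)) (w, s) := fun n => by
    have hn : (0 : ℝ) < 1 / ((n : ℝ) + 1) := by positivity
    rw [differenceQuotient, ← div_eq_inv_mul, le_div_iff₀ hn, mul_comm]
    exact hstep _
  have hlow : ∀ n : ℕ, differenceQuotient F j (-(1 / ((n : ℝ) + 1))) (w, s) ≤ v j := fun n => by
    have hn : -(1 / ((n : ℝ) + 1)) < 0 := by
      have : (0 : ℝ) < 1 / ((n : ℝ) + 1) := by positivity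
      linarith
    rw [differenceQuotient, ← div_eq_inv_mul, div_le_iff_of_neg hn, mul_comm]
    exact hstep _
  have hlim : Tendsto (fun n : ℕ => differenceQuotient F j (1 / ((n : ℝ) + 1)) (w, s)) atTop
      (𝓝 (v j)) := by
    have h2 := (hm j).add_const (v j)
    rw [zero_add] at h2
    refine tendsto_of_tendsto_of_tendsto_of_le_of_le tendsto_const_nhds h2 hup fun n => ?_
    have := hlow n
    dsimp only
    linarith
  exact hlim.limsup_eq.symm

-- Only almost everywhere differentiability of a Lipschitz function along the coordinate axes is
-- needed; full differentiability and convexity of F(·; s) are not.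
omit [MeasurableSpace Ξ] in
lemma ae_mem_mergingSet {F : EuclideanSpace ℝ (Fin d) → Ξ → ℝ} {s : Ξ} {K : NNReal}
    (hF : LipschitzWith K fun w => F w s) :
    ∀ᵐ w ∂(volume : Measure (EuclideanSpace ℝ (Fin d))), (w, s) ∈ mergingSet F := by
  have h : ∀ᵐ w ∂(volume : Measure (EuclideanSpace ℝ (Fin d))), ∀ j : Fin d,
      LineDifferentiableAt ℝ (fun w => F w s) w (EuclideanSpace.single j 1) :=
    ae_all_iff.2 fun j => hF.ae_lineDifferentiableAt _
  filter_upwards [h] with w hw j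
  have hslope := (hw j).hasLineDerivAt.tendsto_slope_zero
  have ht : Tendsto (fun n : ℕ => 1 / ((n : ℝ) + 1)) atTop (𝓝[≠] 0) :=
    tendsto_nhdsWithin_iff.2 ⟨tendsto_one_div_add_atTop_nhds_zero_nat,
      Eventually.of_forall fun n => (by positivity : (0 : ℝ) < 1 / ((n : ℝ) + 1)).ne'⟩
  have ht' : Tendsto (fun n : ℕ => -(1 / ((n : ℝ) + 1))) atTop (𝓝[≠] 0) :=
    tendsto_nhdsWithin_iff.2 ⟨by simpa using
      (tendsto_one_div_add_atTop_nhds_zero_nat (𝕜 := ℝ)).neg,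
      Eventually.of_forall fun n =>
        (neg_neg_of_pos (by positivity : (0 : ℝ) < 1 / ((n : ℝ) + 1))).ne⟩
  simpa [differenceQuotient] using (hslope.comp ht).sub (hslope.comp ht')

/-- Test the subgradient inequality in the direction of the subgradient itself. -/
lemma norm_le_of_mem_subdifferential {h : EuclideanSpace ℝ (Fin d) → ℝ} {C : ℝ} (hC : 0 ≤ C)
    (hh : ∀ v w, |h v - h w| ≤ C * ‖v - w‖) {w v : EuclideanSpace ℝ (Fin d)}
    (hv : v ∈ subdifferential h w) : ‖v‖ ≤ C := by
  have h1 := hv (w + v)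
  have h2 := (le_abs_self _).trans (hh (w + v) w)
  rw [add_sub_cancel_left] at h1 h2
  rw [real_inner_self_eq_norm_sq] at h1
  by_contra hlt
  push Not at hlt
  nlinarith [norm_nonneg v]

/-- Countably many inequalities suffice, which makes the set of pairs where a given measurable field
is a subgradient measurable. -/
lemma mem_subdifferential_of_dense {h : EuclideanSpace ℝ (Fin d) → ℝ} (hh : Continuous h)
    {w v : EuclideanSpace ℝ (Fin d)}
    (hv : ∀ n, h w + inner ℝ v (TopologicalSpace.denseSeq _ n - w)
      ≤ h (TopologicalSpace.denseSeq _ n)) :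
    v ∈ subdifferential h w := by
  have hclosed : IsClosed {x | h w + inner ℝ v (x - w) ≤ h x} :=
    isClosed_le (by fun_prop) hh
  intro x
  have := hclosed.closure_subset_iff.2 (Set.range_subset_iff.2 hv)
  exact this ((TopologicalSpace.denseRange_denseSeq _) x)

/-- The pairs `(w, s)`, `s ∉ S`, in the merging set at which the measurable gradient is a
subgradient. -/
def gradientSet (F : EuclideanSpace ℝ (Fin d) → Ξ → ℝ) (S : Set Ξ) :
    Set (EuclideanSpace ℝ (Fin d) × Ξ) :=
  (mergingSet F ∩ {p | p.2 ∉ S}) ∩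
    {p | ∀ n, F p.1 p.2 + inner ℝ (measurableGradient F p.1 p.2)
      (TopologicalSpace.denseSeq _ n - p.1) ≤ F (TopologicalSpace.denseSeq _ n) p.2}

lemma measurableSet_gradientSet {F : EuclideanSpace ℝ (Fin d) → Ξ → ℝ}
    (hF : Measurable (Function.uncurry F)) {S : Set Ξ} (hS : MeasurableSet S) :
    MeasurableSet (gradientSet F S) := by
  refine ((measurableSet_mergingSet hF).inter (measurable_snd hS.compl)).inter ?_
  rw [Set.ofPred_forall]
  refine MeasurableSet.iInter fun n => measurableSet_le (hF.add ?_) ?_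
  · exact (measurable_measurableGradient hF).inner (measurable_const.sub measurable_fst)
  · exact hF.comp (measurable_const.prodMk measurable_snd)

omit [MeasurableSpace Ξ] in
lemma subdifferential_eq_of_mem_gradientSet {F : EuclideanSpace ℝ (Fin d) → Ξ → ℝ} {S : Set Ξ}
    (hS : ∀ s ∉ S, Continuous fun w => F w s) {p : EuclideanSpace ℝ (Fin d) × Ξ}
    (hp : p ∈ gradientSet F S) :
    subdifferential (fun w => F w p.2) p.1 = {measurableGradient F p.1 p.2} :=
  Set.eq_singleton_iff_unique_mem.2 ⟨mem_subdifferential_of_dense (hS _ hp.1.2) hp.2,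
    fun _ hv => eq_measurableGradient_of_mem_subdifferential hp.1.1 hv⟩

omit [MeasurableSpace Ξ] in
lemma mem_gradientSet {F : EuclideanSpace ℝ (Fin d) → Ξ → ℝ} {S : Set Ξ}
    {p : EuclideanSpace ℝ (Fin d) × Ξ} (hp : p ∈ mergingSet F ∩ {p | p.2 ∉ S})
    (hne : (subdifferential (fun w => F w p.2) p.1).Nonempty) : p ∈ gradientSet F S := by
  obtain ⟨v, hv⟩ := hne
  refine ⟨hp, fun n => ?_⟩
  rw [← eq_measurableGradient_of_mem_subdifferential hp.1 hv]
  exact hv _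

/-- If the random functions `F · s` are Lipschitz and have subgradients at the points
`y₀ + u₀ z` with `z` Gaussian, then off a null set the subdifferential of `F · s` at `w` is a
single vector, which depends measurably on `(w, s)`. -/
theorem exists_gradient_selection {Ω : Type*} [MeasurableSpace Ω] {μ : Measure Ω} {P : Measure Ξ}
    [IsProbabilityMeasure P] {F : EuclideanSpace ℝ (Fin d) → Ξ → ℝ}
    (hF_meas : Measurable (Function.uncurry F)) {C : ℝ} (hC : 0 ≤ C)
    (hF_lip : ∀ᵐ s ∂P, ∀ v w, |F v s - F w s| ≤ C * ‖v - w‖)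
    {Z : Ω → EuclideanSpace ℝ (Fin d)} {ξ : Ω → Ξ}
    (hlaw : HasLaw (fun ω => (Z ω, ξ ω)) ((stdGaussian (EuclideanSpace ℝ (Fin d))).prod P) μ)
    (y₀ : EuclideanSpace ℝ (Fin d)) {u₀ : ℝ} (hu₀ : u₀ ≠ 0)
    (hsub : ∀ᵐ ω ∂μ, (subdifferential (fun w => F w (ξ ω)) (y₀ + u₀ • Z ω)).Nonempty) :
    ∃ (Γ : EuclideanSpace ℝ (Fin d) → Ξ → EuclideanSpace ℝ (Fin d))
      (D : Set (EuclideanSpace ℝ (Fin d) × Ξ)),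
      Measurable (Function.uncurry Γ) ∧ MeasurableSet D ∧
      (∀ p ∈ D, subdifferential (fun w => F w p.2) p.1 = {Γ p.1 p.2}) ∧
      (∀ p ∈ D, ‖Γ p.1 p.2‖ ≤ C) ∧
      ∀ (y : EuclideanSpace ℝ (Fin d)) (u : ℝ), u ≠ 0 → ∀ᵐ p ∂(stdGaussian (EuclideanSpace ℝ (Fin d))).prod P,
        (y + u • p.1, p.2) ∈ D := by
  obtain ⟨S, hSsub, hSmeas, hSnull⟩ := exists_measurable_superset_of_null hF_lip
  have hSlip : ∀ s ∉ S, ∀ v w, |F v s - F w s| ≤ C * ‖v - w‖ := fun s hs => by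
    by_contra h
    exact hs (hSsub h)
  have hSlip' : ∀ s ∉ S, LipschitzWith ⟨C, hC⟩ fun w => F w s := fun s hs =>
    LipschitzWith.of_dist_le_mul fun v w => by
      rw [Real.dist_eq, dist_eq_norm]
      exact hSlip s hs v w
  have hD₀ : MeasurableSet (mergingSet F ∩ {p | p.2 ∉ S}) :=
    (measurableSet_mergingSet hF_meas).inter (measurable_snd hSmeas.compl)
  have hD := measurableSet_gradientSet hF_meas hSmeas
  have hD₀ae : ∀ᵐ p ∂(stdGaussian (EuclideanSpace ℝ (Fin d))).prod P,
      (y₀ + u₀ • p.1, p.2) ∈ mergingSet F ∩ {p | p.2 ∉ S} := by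
    rw [ae_affine_prod_iff hD₀ y₀ hu₀]
    have hS : ∀ᵐ s ∂P, s ∉ S := by simpa [ae_iff] using hSnull
    filter_upwards [hS] with s hs
    filter_upwards [ae_mem_mergingSet (hSlip' s hs)] with w hw
    exact ⟨hw, hs⟩
  have haff : Measurable fun p : EuclideanSpace ℝ (Fin d) × Ξ => (y₀ + u₀ • p.1, p.2) := by
    fun_prop
  -- Existence of a subgradient is known only along the sampled points. Since `gradientSet` is
  -- measurable, the law of the sample turns this into a statement about almost every pair.
  have hDae : ∀ᵐ p ∂(stdGaussian (EuclideanSpace ℝ (Fin d))).prod P,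
      (y₀ + u₀ • p.1, p.2) ∈ gradientSet F S := by
    rw [← hlaw.map_eq] at hD₀ae ⊢
    rw [ae_map_iff hlaw.aemeasurable (haff hD)]
    filter_upwards [ae_of_ae_map hlaw.aemeasurable hD₀ae, hsub] with ω hω hne
    exact mem_gradientSet (p := (y₀ + u₀ • Z ω, ξ ω)) hω hne
  have hsingle := fun p (hp : p ∈ gradientSet F S) =>
    subdifferential_eq_of_mem_gradientSet (fun s hs => (hSlip' s hs).continuous) hp
  refine ⟨measurableGradient F, gradientSet F S, measurable_measurableGradient hF_meas, hD, hsingle,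
    fun p hp => ?_, fun y u hu => ?_⟩
  · refine norm_le_of_mem_subdifferential hC (hSlip _ hp.1.2) (w := p.1) ?_
    rw [hsingle p hp]
    exact Set.mem_singleton _
  -- Both statements are equivalent to the same one about Lebesgue-almost every w, so the single
  -- centre y₀ and scale u₀ give all others.
  · rw [ae_affine_prod_iff hD y hu]
    rwa [ae_affine_prod_iff hD y₀ hu₀] at hDae

end GradientSelection

/-! ### Symmetry and norm moments of the standard Gaussian. -/

section GaussianNorm

variable {d : ℕ}

lemma stdGaussian_map_neg :
    (stdGaussian (EuclideanSpace ℝ (Fin d))).map (fun z => -z) = stdGaussian _ :=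
  stdGaussian_map (LinearIsometryEquiv.neg ℝ (E := EuclideanSpace ℝ (Fin d)))

lemma memLp_norm_stdGaussian :
    MemLp (fun z => ‖z‖) 2 (stdGaussian (EuclideanSpace ℝ (Fin d))) :=
  (IsGaussian.memLp_two_id (μ := stdGaussian (EuclideanSpace ℝ (Fin d)))).norm

lemma integrable_norm_stdGaussian :
    Integrable (fun z => ‖z‖) (stdGaussian (EuclideanSpace ℝ (Fin d))) :=
  memLp_norm_stdGaussian.integrable (by norm_num)

lemma integral_norm_sq_stdGaussian :
    ∫ z, ‖z‖ ^ 2 ∂(stdGaussian (EuclideanSpace ℝ (Fin d))) = d := by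
  have hcoord : ∀ j : Fin d, MemLp (fun z : EuclideanSpace ℝ (Fin d) => z j) 2
      (stdGaussian (EuclideanSpace ℝ (Fin d))) := fun j =>
    memLp_norm_stdGaussian.of_le (by fun_prop)
      (Filter.Eventually.of_forall fun z => by
        simpa using PiLp.norm_apply_le z j)
  have hone : ∀ j : Fin d, ∫ z, (z j) ^ 2 ∂(stdGaussian (EuclideanSpace ℝ (Fin d))) = 1 := by
    intro j
    have hfun : ∀ z : EuclideanSpace ℝ (Fin d),
        innerSL ℝ (EuclideanSpace.single j (1 : ℝ)) z = z j := fun z => by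
      simp [EuclideanSpace.inner_single_left]
    have hvar := variance_dual_stdGaussian (innerSL ℝ (EuclideanSpace.single j (1 : ℝ)))
    have hmean := integral_strongDual_stdGaussian (innerSL ℝ (EuclideanSpace.single j (1 : ℝ)))
    rw [variance_eq_sub (by simpa only [funext hfun] using hcoord j), hmean, innerSL_apply_norm] at hvar
    have hfun' : ∀ z : EuclideanSpace ℝ (Fin d),
        inner ℝ (EuclideanSpace.single j (1 : ℝ)) z = z j := hfun
    simpa [hfun'] using hvar
  simp_rw [EuclideanSpace.real_norm_sq_eq]
  rw [integral_finsetSum _ fun j _ => (hcoord j).integrable_sq]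
  simp [hone]

lemma integral_norm_stdGaussian_le :
    ∫ z, ‖z‖ ∂(stdGaussian (EuclideanSpace ℝ (Fin d))) ≤ √(d : ℝ) := by
  have h := variance_eq_sub (memLp_norm_stdGaussian (d := d))
  have h0 := variance_nonneg (fun z => ‖z‖) (stdGaussian (EuclideanSpace ℝ (Fin d)))
  simp only [Pi.pow_apply, integral_norm_sq_stdGaussian] at h
  exact Real.le_sqrt_of_sq_le (by linarith)

end GaussianNorm

/-! ### Gaussian smoothing of a convex Lipschitz function. -/

section Smoothing

variable {d : ℕ}

/-- The Gaussian smoothing `f_u(y) = 𝔼 f(y + u Z)`, `Z ∼ N(0, I)`. -/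
def gaussianSmoothing (f : EuclideanSpace ℝ (Fin d) → ℝ) (u : ℝ)
    (y : EuclideanSpace ℝ (Fin d)) : ℝ :=
  ∫ z, f (y + u • z) ∂(stdGaussian (EuclideanSpace ℝ (Fin d)))

variable {f : EuclideanSpace ℝ (Fin d) → ℝ} {C : ℝ}

lemma continuous_of_abs_sub_le (hf : ∀ v w, |f v - f w| ≤ C * ‖v - w‖) : Continuous f := by
  refine (LipschitzWith.of_dist_le' (K := C) fun v w => ?_).continuous
  rw [Real.dist_eq, dist_eq_norm]
  exact hf v w

lemma integrable_comp_affine_stdGaussian (hf : ∀ v w, |f v - f w| ≤ C * ‖v - w‖)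
    (y : EuclideanSpace ℝ (Fin d)) (u : ℝ) :
    Integrable (fun z => f (y + u • z)) (stdGaussian (EuclideanSpace ℝ (Fin d))) := by
  have hc := continuous_of_abs_sub_le hf
  refine ((integrable_const |f y|).add (integrable_norm_stdGaussian.const_mul (C * |u|))).mono'
    (by fun_prop) (Filter.Eventually.of_forall fun z => ?_)
  have h := hf (y + u • z) y
  rw [add_sub_cancel_left, norm_smul, Real.norm_eq_abs] at h
  have h2 := abs_sub_abs_le_abs_sub (f (y + u • z)) (f y)
  simp only [Pi.add_apply, Real.norm_eq_abs]
  nlinarith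

lemma gaussianSmoothing_neg (u : ℝ) (y : EuclideanSpace ℝ (Fin d)) :
    gaussianSmoothing f (-u) y = gaussianSmoothing f u y := by
  have hme : MeasurableEmbedding (fun z : EuclideanSpace ℝ (Fin d) => -z) :=
    (MeasurableEquiv.neg _).measurableEmbedding
  unfold gaussianSmoothing
  conv_rhs => rw [← stdGaussian_map_neg, hme.integral_map]
  simp

/-- The point y is the midpoint of y + uz and y - uz, and the two have equal mean values by
symmetry. -/
lemma le_gaussianSmoothing (hf : ∀ v w, |f v - f w| ≤ C * ‖v - w‖) (hconv : ConvexOn ℝ Set.univ f)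
    (u : ℝ) (y : EuclideanSpace ℝ (Fin d)) : f y ≤ gaussianSmoothing f u y := by
  have hsum : gaussianSmoothing f u y + gaussianSmoothing f (-u) y
      = ∫ z, (f (y + u • z) + f (y + (-u) • z)) ∂(stdGaussian (EuclideanSpace ℝ (Fin d))) :=
    (integral_add (integrable_comp_affine_stdGaussian hf y u)
      (integrable_comp_affine_stdGaussian hf y (-u))).symm
  have hle : ∫ _z, 2 * f y ∂(stdGaussian (EuclideanSpace ℝ (Fin d)))
      ≤ ∫ z, (f (y + u • z) + f (y + (-u) • z)) ∂(stdGaussian (EuclideanSpace ℝ (Fin d))) := by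
    refine integral_mono (integrable_const _) ((integrable_comp_affine_stdGaussian hf y u).add
      (integrable_comp_affine_stdGaussian hf y (-u))) fun z => ?_
    have h := hconv.2 (Set.mem_univ (y + u • z)) (Set.mem_univ (y + (-u) • z))
      (by norm_num : (0 : ℝ) ≤ 1 / 2) (by norm_num : (0 : ℝ) ≤ 1 / 2) (by norm_num)
    have hpt : (1 / 2 : ℝ) • (y + u • z) + (1 / 2 : ℝ) • (y + (-u) • z) = y := by module
    rw [hpt] at h
    simp only [smul_eq_mul] at h
    dsimp only
    linarith
  rw [← hsum, gaussianSmoothing_neg] at hle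
  simp at hle
  linarith

/-- The point y + u'z divides the segment from y to y + uz in the ratio u'/u; average the convexity
inequality and use f y ≤ f_u y. -/
lemma gaussianSmoothing_mono (hf : ∀ v w, |f v - f w| ≤ C * ‖v - w‖)
    (hconv : ConvexOn ℝ Set.univ f) {u u' : ℝ} (hu' : 0 ≤ u') (hu : u' ≤ u)
    (y : EuclideanSpace ℝ (Fin d)) : gaussianSmoothing f u' y ≤ gaussianSmoothing f u y := by
  rcases hu'.eq_or_lt with rfl | hpos
  · simpa [gaussianSmoothing] using le_gaussianSmoothing hf hconv u y
  have hu0 : 0 < u := hpos.trans_le hu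
  have hle : gaussianSmoothing f u' y ≤ ∫ z, (u' / u * f (y + u • z) + (1 - u' / u) * f y)
      ∂(stdGaussian (EuclideanSpace ℝ (Fin d))) := by
    refine integral_mono (integrable_comp_affine_stdGaussian hf y u')
      (((integrable_comp_affine_stdGaussian hf y u).const_mul _).add (integrable_const _))
      fun z => ?_
    have h := hconv.2 (Set.mem_univ (y + u • z)) (Set.mem_univ y)
      (by positivity : 0 ≤ u' / u) (sub_nonneg.2 ((div_le_one hu0).2 hu)) (by ring)
    have hpt : (u' / u) • (y + u • z) + (1 - u' / u) • y = y + u' • z := by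
      rw [smul_add, smul_smul, div_mul_cancel₀ _ hu0.ne']
      module
    rw [hpt] at h
    simpa only [smul_eq_mul] using h
  rw [integral_add ((integrable_comp_affine_stdGaussian hf y u).const_mul _) (integrable_const _),
    integral_const_mul] at hle
  simp only [integral_const, probReal_univ, one_smul] at hle
  change _ ≤ u' / u * gaussianSmoothing f u y + _ at hle
  have h1 := le_gaussianSmoothing hf hconv u y
  have h2 : 0 ≤ 1 - u' / u := sub_nonneg.2 ((div_le_one hu0).2 hu)
  nlinarith

lemma gaussianSmoothing_le (hf : ∀ v w, |f v - f w| ≤ C * ‖v - w‖) (hC : 0 ≤ C) {u : ℝ}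
    (hu : 0 ≤ u) (y : EuclideanSpace ℝ (Fin d)) :
    gaussianSmoothing f u y ≤ f y + C * u * √(d : ℝ) := by
  have hle : gaussianSmoothing f u y ≤ ∫ z, (f y + C * u * ‖z‖)
      ∂(stdGaussian (EuclideanSpace ℝ (Fin d))) := by
    refine integral_mono (integrable_comp_affine_stdGaussian hf y u)
      ((integrable_const _).add (integrable_norm_stdGaussian.const_mul _)) fun z => ?_
    have h := (le_abs_self _).trans (hf (y + u • z) y)
    rw [add_sub_cancel_left, norm_smul, Real.norm_eq_abs, abs_of_nonneg hu] at h
    dsimp only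
    linarith
  rw [integral_add (integrable_const _) (integrable_norm_stdGaussian.const_mul _),
    integral_const_mul] at hle
  simp only [integral_const, probReal_univ, one_smul] at hle
  have := mul_le_mul_of_nonneg_left (integral_norm_stdGaussian_le (d := d)) (mul_nonneg hC hu)
  linarith

lemma abs_gaussianSmoothing_sub_le (hf : ∀ v w, |f v - f w| ≤ C * ‖v - w‖) (u : ℝ)
    (v w : EuclideanSpace ℝ (Fin d)) :
    |gaussianSmoothing f u v - gaussianSmoothing f u w| ≤ C * ‖v - w‖ := by
  unfold gaussianSmoothing
  rw [← integral_sub (integrable_comp_affine_stdGaussian hf v u)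
    (integrable_comp_affine_stdGaussian hf w u)]
  have h := norm_integral_le_of_norm_le_const (μ := stdGaussian (EuclideanSpace ℝ (Fin d)))
    (f := fun z => f (v + u • z) - f (w + u • z)) (C := C * ‖v - w‖)
    (Filter.Eventually.of_forall fun z => by
      rw [Real.norm_eq_abs]
      simpa using hf (v + u • z) (w + u • z))
  simpa using h

end Smoothing

/-! ### Subgradient inequality and descent lemma for the smoothed objective. -/

section SmoothedGradient

variable {d : ℕ} {Ξ : Type*} [MeasurableSpace Ξ]

/-- The random functions `F · s`, `s ∼ P`, are `C`-Lipschitz, and `Γ` is their gradient wherever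
that exists: off a null set `D` of pairs `(w, s)`, `Γ w s` is the only subgradient of `F · s` at
`w`. -/
structure IsGradientSelection (F : EuclideanSpace ℝ (Fin d) → Ξ → ℝ) (P : Measure Ξ) (C : ℝ)
    (Γ : EuclideanSpace ℝ (Fin d) → Ξ → EuclideanSpace ℝ (Fin d))
    (D : Set (EuclideanSpace ℝ (Fin d) × Ξ)) : Prop where
  measurable_fun : Measurable (Function.uncurry F)
  integrable_fun : ∀ w, Integrable (F w) P
  lipschitz : ∀ᵐ s ∂P, ∀ v w, |F v s - F w s| ≤ C * ‖v - w‖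
  measurable : Measurable (Function.uncurry Γ)
  measurableSet : MeasurableSet D
  subdifferential_eq : ∀ p ∈ D, subdifferential (fun w => F w p.2) p.1 = {Γ p.1 p.2}
  norm_le : ∀ p ∈ D, ‖Γ p.1 p.2‖ ≤ C
  ae_mem : ∀ (y : EuclideanSpace ℝ (Fin d)) (u : ℝ), u ≠ 0 →
    ∀ᵐ p ∂(stdGaussian (EuclideanSpace ℝ (Fin d))).prod P, (y + u • p.1, p.2) ∈ D

/-- The gradient `𝔼 Γ(y + u Z; ξ)` of the smoothed objective. -/
def smoothedGradient (Γ : EuclideanSpace ℝ (Fin d) → Ξ → EuclideanSpace ℝ (Fin d))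
    (P : Measure Ξ) (u : ℝ) (y : EuclideanSpace ℝ (Fin d)) : EuclideanSpace ℝ (Fin d) :=
  ∫ p, Γ (y + u • p.1) p.2 ∂(stdGaussian (EuclideanSpace ℝ (Fin d))).prod P

namespace IsGradientSelection

variable {F : EuclideanSpace ℝ (Fin d) → Ξ → ℝ} {P : Measure Ξ} [IsProbabilityMeasure P] {C : ℝ}
  {Γ : EuclideanSpace ℝ (Fin d) → Ξ → EuclideanSpace ℝ (Fin d)}
  {D : Set (EuclideanSpace ℝ (Fin d) × Ξ)}

lemma abs_expectedObjective_sub_le (h : IsGradientSelection F P C Γ D)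
    (v w : EuclideanSpace ℝ (Fin d)) :
    |expectedObjective F P v - expectedObjective F P w| ≤ C * ‖v - w‖ := by
  unfold expectedObjective
  rw [← integral_sub (h.integrable_fun v) (h.integrable_fun w)]
  have h := norm_integral_le_of_norm_le_const (μ := P)
    (f := fun s => F v s - F w s) (C := C * ‖v - w‖)
    (by filter_upwards [h.lipschitz] with s hs using hs v w)
  simpa using h

lemma integrable_comp_affine (h : IsGradientSelection F P C Γ D) (y : EuclideanSpace ℝ (Fin d))
    (u : ℝ) : Integrable (fun p : EuclideanSpace ℝ (Fin d) × Ξ => F (y + u • p.1) p.2)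
      ((stdGaussian (EuclideanSpace ℝ (Fin d))).prod P) := by
  have h1 : Integrable (fun p : EuclideanSpace ℝ (Fin d) × Ξ => |F y p.2| + C * |u| * ‖p.1‖)
      ((stdGaussian (EuclideanSpace ℝ (Fin d))).prod P) :=
    ((h.integrable_fun y).abs.comp_snd _).add
      ((integrable_norm_stdGaussian.comp_fst _).const_mul _)
  refine h1.mono' ?_ ?_
  · exact (h.measurable_fun.comp (by fun_prop : Measurable
      fun p : EuclideanSpace ℝ (Fin d) × Ξ => (y + u • p.1, p.2))).aestronglyMeasurable
  · have hs := (Measure.quasiMeasurePreserving_snd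
      (μ := stdGaussian (EuclideanSpace ℝ (Fin d))) (ν := P)).ae h.lipschitz
    filter_upwards [hs] with p hp
    have h := hp (y + u • p.1) y
    rw [add_sub_cancel_left, norm_smul, Real.norm_eq_abs] at h
    have h2 := abs_sub_abs_le_abs_sub (F (y + u • p.1) p.2) (F y p.2)
    rw [Real.norm_eq_abs]
    linarith

lemma gaussianSmoothing_eq (h : IsGradientSelection F P C Γ D) (u : ℝ)
    (y : EuclideanSpace ℝ (Fin d)) :
    gaussianSmoothing (expectedObjective F P) u y
      = ∫ p, F (y + u • p.1) p.2 ∂(stdGaussian (EuclideanSpace ℝ (Fin d))).prod P := by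
  rw [integral_prod _ (h.integrable_comp_affine y u)]
  rfl

omit [IsProbabilityMeasure P] in
lemma measurable_comp_affine (h : IsGradientSelection F P C Γ D) (y : EuclideanSpace ℝ (Fin d))
    (u : ℝ) : Measurable (fun p : EuclideanSpace ℝ (Fin d) × Ξ => Γ (y + u • p.1) p.2) :=
  h.measurable.comp (by fun_prop : Measurable
    fun p : EuclideanSpace ℝ (Fin d) × Ξ => (y + u • p.1, p.2))

omit [IsProbabilityMeasure P] in
lemma ae_norm_le (h : IsGradientSelection F P C Γ D) (y : EuclideanSpace ℝ (Fin d))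
    {u : ℝ} (hu : u ≠ 0) : ∀ᵐ p ∂(stdGaussian (EuclideanSpace ℝ (Fin d))).prod P,
      ‖Γ (y + u • p.1) p.2‖ ≤ C := by
  filter_upwards [h.ae_mem y u hu] with p hp
  exact h.norm_le (y + u • p.1, p.2) hp

lemma nonneg (h : IsGradientSelection F P C Γ D) : 0 ≤ C := by
  obtain ⟨p, hp⟩ := (h.ae_norm_le 0 one_ne_zero).exists
  exact (norm_nonneg _).trans hp

lemma integrable_gradient (h : IsGradientSelection F P C Γ D) (y : EuclideanSpace ℝ (Fin d))
    {u : ℝ} (hu : u ≠ 0) : Integrable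
      (fun p : EuclideanSpace ℝ (Fin d) × Ξ => Γ (y + u • p.1) p.2)
      ((stdGaussian (EuclideanSpace ℝ (Fin d))).prod P) :=
  Integrable.of_bound (h.measurable_comp_affine y u).aestronglyMeasurable C (h.ae_norm_le y hu)

lemma norm_smoothedGradient_le (h : IsGradientSelection F P C Γ D) (y : EuclideanSpace ℝ (Fin d))
    {u : ℝ} (hu : u ≠ 0) : ‖smoothedGradient Γ P u y‖ ≤ C := by
  have := norm_integral_le_of_norm_le_const (h.ae_norm_le y hu)
  rw [probReal_univ, mul_one] at this
  exact this

/-- The smoothed gradient is a subgradient of the smoothed objective. -/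
lemma gaussianSmoothing_add_inner_le (h : IsGradientSelection F P C Γ D) {u : ℝ} (hu : u ≠ 0)
    (y w : EuclideanSpace ℝ (Fin d)) :
    gaussianSmoothing (expectedObjective F P) u y + inner ℝ (smoothedGradient Γ P u y) (w - y)
      ≤ gaussianSmoothing (expectedObjective F P) u w := by
  rw [h.gaussianSmoothing_eq, h.gaussianSmoothing_eq, smoothedGradient, real_inner_comm,
    ← integral_inner (h.integrable_gradient y hu), ← integral_add (h.integrable_comp_affine y u)
      ((h.integrable_gradient y hu).const_inner _)]
  refine integral_mono_ae ((h.integrable_comp_affine y u).add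
    ((h.integrable_gradient y hu).const_inner _)) (h.integrable_comp_affine w u) ?_
  filter_upwards [h.ae_mem y u hu] with p hp
  have hmem : Γ (y + u • p.1) p.2 ∈ subdifferential (fun w => F w p.2) (y + u • p.1) := by
    have := h.subdifferential_eq _ hp
    dsimp only at this
    rw [this]
    exact Set.mem_singleton _
  have := hmem (w + u • p.1)
  rw [real_inner_comm]
  simpa using this

/-- Moving the centre by u • a translates the Gaussian variable by a, and the averaged integrand is
bounded by C ‖v‖. This local form of Lipschitz continuity has the sharp constant only as a → 0. -/
lemma inner_smoothedGradient_add_le (h : IsGradientSelection F P C Γ D) {u : ℝ} (hu : u ≠ 0)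
    (y a v : EuclideanSpace ℝ (Fin d)) :
    inner ℝ v (smoothedGradient Γ P u (y + u • a)) ≤ inner ℝ v (smoothedGradient Γ P u y)
      + C * ‖v‖ * √(Real.exp (‖a‖ ^ 2) - 1) := by
  have key : ∀ y, inner ℝ v (smoothedGradient Γ P u y)
      = ∫ z, ∫ s, inner ℝ v (Γ (y + u • z) s) ∂P ∂(stdGaussian (EuclideanSpace ℝ (Fin d))) := by
    intro y
    rw [smoothedGradient, ← integral_inner (h.integrable_gradient y hu),
      integral_prod _ ((h.integrable_gradient y hu).const_inner _)]
  rw [key, key]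
  have hshift : ∀ z : EuclideanSpace ℝ (Fin d), y + u • a + u • z = y + u • (z + a) := fun z => by
    module
  simp_rw [hshift]
  have hb : ∀ᵐ z ∂(stdGaussian (EuclideanSpace ℝ (Fin d))),
      |∫ s, inner ℝ v (Γ (y + u • z) s) ∂P| ≤ C * ‖v‖ := by
    filter_upwards [Measure.ae_ae_of_ae_prod (h.ae_norm_le y hu)] with z hz
    have := norm_integral_le_of_norm_le_const (μ := P)
      (f := fun s => inner ℝ v (Γ (y + u • z) s)) (C := C * ‖v‖) (by
        filter_upwards [hz] with s hs
        refine (norm_inner_le_norm _ _).trans ?_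
        rw [mul_comm]
        gcongr)
    simpa using this
  have := integral_add_stdGaussian_sub_le
    (h := fun z => ∫ s, inner ℝ v (Γ (y + u • z) s) ∂P)
    (AEStronglyMeasurable.integral_prod_right'
      (f := fun p => inner ℝ v (Γ (y + u • p.1) p.2))
      ((h.integrable_gradient y hu).const_inner v).aestronglyMeasurable) hb a
  linarith

lemma inner_smoothedGradient_add_nsmul_le (h : IsGradientSelection F P C Γ D) {u : ℝ} (hu : u ≠ 0)
    (y a v : EuclideanSpace ℝ (Fin d)) (k : ℕ) :
    inner ℝ v (smoothedGradient Γ P u (y + (k : ℝ) • u • a))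
      ≤ inner ℝ v (smoothedGradient Γ P u y) + k * (C * ‖v‖ * √(Real.exp (‖a‖ ^ 2) - 1)) := by
  induction k with
  | zero => simp
  | succ k ih =>
    have hstep := h.inner_smoothedGradient_add_le hu (y + (k : ℝ) • u • a) a v
    have hpt : y + ((k + 1 : ℕ) : ℝ) • u • a = y + (k : ℝ) • u • a + u • a := by
      push_cast
      module
    rw [hpt]
    push_cast
    linarith

/-- On each of the k pieces the increment is at most the slope at the far end, and the slope after j
pieces has grown by at most j increments; 1 + ⋯ + k gives k (k + 1) / 2. -/
lemma gaussianSmoothing_add_nsmul_le (h : IsGradientSelection F P C Γ D) {u : ℝ} (hu : u ≠ 0)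
    (y a : EuclideanSpace ℝ (Fin d)) (k : ℕ) :
    gaussianSmoothing (expectedObjective F P) u (y + (k : ℝ) • u • a)
      ≤ gaussianSmoothing (expectedObjective F P) u y
        + k * inner ℝ (u • a) (smoothedGradient Γ P u y)
        + k * (k + 1) / 2 * (C * ‖u • a‖ * √(Real.exp (‖a‖ ^ 2) - 1)) := by
  induction k with
  | zero => simp
  | succ k ih =>
    have hpt : y + (k : ℝ) • u • a - (y + ((k + 1 : ℕ) : ℝ) • u • a) = -(u • a) := by
      push_cast
      module
    have hsub := h.gaussianSmoothing_add_inner_le hu (y + ((k + 1 : ℕ) : ℝ) • u • a)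
      (y + (k : ℝ) • u • a)
    rw [hpt, inner_neg_right, real_inner_comm] at hsub
    have hgrad := h.inner_smoothedGradient_add_nsmul_le hu y a (u • a) (k + 1)
    push_cast at hsub hgrad ⊢
    linarith

/-- The smoothed objective has a `C / u`-Lipschitz gradient, in the form of the descent lemma. -/
lemma gaussianSmoothing_add_le (h : IsGradientSelection F P C Γ D) {u : ℝ} (hu : 0 < u)
    (y v : EuclideanSpace ℝ (Fin d)) :
    gaussianSmoothing (expectedObjective F P) u (y + v)
      ≤ gaussianSmoothing (expectedObjective F P) u y
        + inner ℝ (smoothedGradient Γ P u y) v + C / u / 2 * ‖v‖ ^ 2 := by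
  have hC := h.nonneg
  -- The segment is cut into n + 1 pieces of length t n ‖v‖. As n → ∞ the local bound becomes linear
  -- in the step, and (n + 1)(n + 2) (t n)² = 1 + t n tends to 1, leaving exactly C / u / 2.
  let t : ℕ → ℝ := fun n => 1 / ((n : ℝ) + 1)
  have ht : Filter.Tendsto t Filter.atTop (nhds 0) := tendsto_one_div_add_atTop_nhds_zero_nat
  have hbound : ∀ n : ℕ, gaussianSmoothing (expectedObjective F P) u (y + v)
      ≤ gaussianSmoothing (expectedObjective F P) u y + inner ℝ (smoothedGradient Γ P u y) v
        + (1 + t n) * (C / u / 2 * ‖v‖ ^ 2) * Real.exp ((t n / u * ‖v‖) ^ 2 / 2) := by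
    intro n
    have htn : 0 < t n := by positivity
    have hn : (((n + 1 : ℕ) : ℝ)) * t n = 1 := by
      simp only [t]
      push_cast
      field_simp
    have hua : u • (t n / u) • v = t n • v := by
      rw [smul_smul, mul_div_cancel₀ _ hu.ne']
    have h1 := h.gaussianSmoothing_add_nsmul_le hu.ne' y ((t n / u) • v) (n + 1)
    have hr : ‖(t n / u) • v‖ = t n / u * ‖v‖ := by
      rw [norm_smul, Real.norm_of_nonneg (by positivity)]
    rw [hua, smul_smul, hn, one_smul, hr, real_inner_smul_left, ← mul_assoc, hn, one_mul,
      norm_smul, Real.norm_of_nonneg htn.le, real_inner_comm] at h1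
    refine h1.trans ?_
    set r := t n / u * ‖v‖ with hrdef
    -- Multiply 1 - e^{-r²} ≤ r² by e^{r²}.
    have hsqrt : √(Real.exp (r ^ 2) - 1) ≤ r * Real.exp (r ^ 2 / 2) := by
      refine Real.sqrt_le_iff.2 ⟨by positivity, ?_⟩
      have h2 : Real.exp (r ^ 2 / 2) ^ 2 = Real.exp (r ^ 2) := by
        rw [← Real.exp_nat_mul]
        ring_nf
      rw [mul_pow r (Real.exp _), h2]
      have h3 := Real.one_sub_le_exp_neg (r ^ 2)
      rw [Real.exp_neg] at h3
      have h4 := Real.exp_pos (r ^ 2)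
      have h5 : (Real.exp (r ^ 2))⁻¹ * Real.exp (r ^ 2) = 1 := inv_mul_cancel₀ h4.ne'
      nlinarith
    have hfin : ((n + 1 : ℕ) : ℝ) * (((n + 1 : ℕ) : ℝ) + 1) / 2 * (C * (t n * ‖v‖)
          * (r * Real.exp (r ^ 2 / 2)))
        = (1 + t n) * (C / u / 2 * ‖v‖ ^ 2) * Real.exp (r ^ 2 / 2) := by
      have h6 : ((n + 1 : ℕ) : ℝ) * (((n + 1 : ℕ) : ℝ) + 1) * (t n * t n) = 1 + t n := by
        linear_combination (((n + 1 : ℕ) : ℝ) * t n + 1 + t n) * hn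
      rw [hrdef] at *
      rw [← h6]
      ring
    have hle : ((n + 1 : ℕ) : ℝ) * (((n + 1 : ℕ) : ℝ) + 1) / 2 * (C * (t n * ‖v‖)
          * √(Real.exp (r ^ 2) - 1))
        ≤ ((n + 1 : ℕ) : ℝ) * (((n + 1 : ℕ) : ℝ) + 1) / 2 * (C * (t n * ‖v‖)
          * (r * Real.exp (r ^ 2 / 2))) := by
      gcongr
    linarith
  have hlim : Filter.Tendsto (fun n => gaussianSmoothing (expectedObjective F P) u y
      + inner ℝ (smoothedGradient Γ P u y) v
      + (1 + t n) * (C / u / 2 * ‖v‖ ^ 2) * Real.exp ((t n / u * ‖v‖) ^ 2 / 2)) Filter.atTop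
      (nhds (gaussianSmoothing (expectedObjective F P) u y
        + inner ℝ (smoothedGradient Γ P u y) v
        + (1 + 0) * (C / u / 2 * ‖v‖ ^ 2) * Real.exp ((0 / u * ‖v‖) ^ 2 / 2))) := by
    have hc : Continuous fun x : ℝ => gaussianSmoothing (expectedObjective F P) u y
      + inner ℝ (smoothedGradient Γ P u y) v
      + (1 + x) * (C / u / 2 * ‖v‖ ^ 2) * Real.exp ((x / u * ‖v‖) ^ 2 / 2) := by fun_prop
    exact (hc.tendsto 0).comp ht
  have := ge_of_tendsto' hlim hbound
  simpa using this

end IsGradientSelection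

end SmoothedGradient

/-! ### The averaging weights. -/

section Theta

lemma theta_pos (t : ℕ) : 0 < theta t := by
  cases t with
  | zero => simp [theta]
  | succ t =>
    rw [theta]
    positivity

lemma one_div_theta_succ (t : ℕ) :
    1 / theta (t + 1) = (1 + √(1 + 4 / theta t ^ 2)) / 2 := by
  rw [theta, one_div_div]

/-- The recursion makes b = 1/θ_{t+1} the positive root of b² - b = 1/θ_t²; the linear bounds on
1/θ_t also come from this relation. -/
lemma one_div_theta_succ_sq (t : ℕ) :
    (1 / theta (t + 1)) ^ 2 = (1 / theta t) ^ 2 + 1 / theta (t + 1) := by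
  rw [one_div_theta_succ]
  have h : √(1 + 4 / theta t ^ 2) ^ 2 = 1 + 4 / theta t ^ 2 :=
    Real.sq_sqrt (by positivity)
  have h2 : (1 / theta t) ^ 2 = 1 / theta t ^ 2 := by rw [div_pow, one_pow]
  rw [h2]
  linear_combination h / 4

lemma sum_one_div_theta (t : ℕ) :
    ∑ τ ∈ Finset.range (t + 1), 1 / theta τ = (1 / theta t) ^ 2 := by
  induction t with
  | zero => simp [theta]
  | succ t ih => rw [Finset.sum_range_succ, ih, one_div_theta_succ_sq]

lemma one_div_theta_pos (t : ℕ) : 0 < 1 / theta t := one_div_pos.2 (theta_pos t)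

lemma one_div_theta_add_half_le (t : ℕ) : 1 / theta t + 1 / 2 ≤ 1 / theta (t + 1) := by
  have h := one_div_theta_succ_sq t
  have h1 := one_div_theta_pos t
  have h2 := one_div_theta_pos (t + 1)
  have h3 : 1 < 1 / theta (t + 1) := by
    by_contra hle
    push Not at hle
    nlinarith
  by_contra hlt
  push Not at hlt
  nlinarith

lemma one_div_theta_succ_le (t : ℕ) : 1 / theta (t + 1) ≤ 1 / theta t + 1 := by
  have h := one_div_theta_succ_sq t
  have h1 := one_div_theta_pos t
  have h2 := one_div_theta_pos (t + 1)
  by_contra hlt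
  push Not at hlt
  nlinarith

lemma one_add_half_le_one_div_theta (t : ℕ) : 1 + (t : ℝ) / 2 ≤ 1 / theta t := by
  induction t with
  | zero => simp [theta]
  | succ t ih =>
    have := one_div_theta_add_half_le t
    push_cast
    linarith

lemma one_div_theta_le (t : ℕ) : 1 / theta t ≤ t + 1 := by
  induction t with
  | zero => simp [theta]
  | succ t ih =>
    have := one_div_theta_succ_le t
    push_cast
    linarith

lemma theta_le_one (t : ℕ) : theta t ≤ 1 := by
  have h := one_add_half_le_one_div_theta t
  have h0 : (0 : ℝ) ≤ t := t.cast_nonneg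
  have h1 : 1 ≤ 1 / theta t := by linarith
  exact (one_le_div (theta_pos t)).1 h1

lemma theta_succ_le (t : ℕ) : theta (t + 1) ≤ theta t := by
  have h := one_div_theta_add_half_le t
  exact (one_div_le_one_div (theta_pos t) (theta_pos (t + 1))).1 (by linarith)

/-- The identity that makes the weighted estimates telescope: the old point enters with the factor 1
- θ_{t+1}. -/
lemma one_sub_theta_succ (t : ℕ) :
    (1 / theta (t + 1)) ^ 2 * (1 - theta (t + 1)) = (1 / theta t) ^ 2 := by
  have h := one_div_theta_succ_sq t
  have h2 := (theta_pos (t + 1)).ne'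
  have h3 : (1 / theta (t + 1)) ^ 2 * theta (t + 1) = 1 / theta (t + 1) := by
    field_simp
  linarith

end Theta

/-! ### Minimizers of strongly convex objectives. -/

section Argmin

variable {d : ℕ}

/-- Quadratic growth at a minimizer: compare z with the point (1 - l) z + l w, divide by l, and let
l → 0. -/
lemma strongConvexOn_add_sq_le {E : Type*} [NormedAddCommGroup E] [InnerProductSpace ℝ E]
    {X : Set E} {φ ψ : E → ℝ}
    (hφ : ConvexOn ℝ X φ) (hψ : StrongConvexOn X 1 ψ) (s : E) {c κ : ℝ} (hc : 0 ≤ c) (hκ : 0 ≤ κ)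
    {z w : E} (hz : z ∈ X) (hw : w ∈ X)
    (hmin : IsMinOn (fun x => inner ℝ s x + c * φ x + κ * ψ x) X z) :
    inner ℝ s z + c * φ z + κ * ψ z + κ / 2 * ‖w - z‖ ^ 2
      ≤ inner ℝ s w + c * φ w + κ * ψ w := by
  set J : E → ℝ := fun x => inner ℝ s x + c * φ x + κ * ψ x with hJ
  have hkey : ∀ l : ℝ, 0 < l → l < 1 → (1 - l) * (κ / 2 * ‖w - z‖ ^ 2) ≤ J w - J z := by
    intro l h0 h1
    have hmem : (1 - l) • z + l • w ∈ X := hφ.1 hz hw (by linarith) h0.le (by ring)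
    have hm : J z ≤ J ((1 - l) • z + l • w) := hmin hmem
    have h2 := hφ.2 hz hw (by linarith : 0 ≤ 1 - l) h0.le (by ring)
    have h3 := hψ.2 hz hw (by linarith : 0 ≤ 1 - l) h0.le (by ring)
    simp only [smul_eq_mul] at h2 h3
    rw [norm_sub_rev] at h3
    have h4 := mul_le_mul_of_nonneg_left h2 hc
    have h5 := mul_le_mul_of_nonneg_left h3 hκ
    simp only [hJ, inner_add_right, real_inner_smul_right] at hm ⊢
    have h6 : 0 ≤ l * (inner ℝ s w + c * φ w + κ * ψ w - (inner ℝ s z + c * φ z + κ * ψ z)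
        - (1 - l) * (κ / 2 * ‖w - z‖ ^ 2)) := by
      nlinarith
    nlinarith [nonneg_of_mul_nonneg_right h6 h0]
  have hlim : Filter.Tendsto (fun l : ℝ => (1 - l) * (κ / 2 * ‖w - z‖ ^ 2)) (nhdsWithin 0 (Set.Ioi 0))
      (nhds ((1 - 0) * (κ / 2 * ‖w - z‖ ^ 2))) := by
    have hcont : Continuous fun l : ℝ => (1 - l) * (κ / 2 * ‖w - z‖ ^ 2) := by fun_prop
    exact (hcont.tendsto 0).mono_left nhdsWithin_le_nhds
  have hfin := le_of_tendsto hlim (b := J w - J z) (by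
    filter_upwards [Ioo_mem_nhdsGT (zero_lt_one' ℝ)] with l hl
    exact hkey l hl.1 hl.2)
  simp only [hJ] at hfin
  linarith

/-- The minimizer of a strongly convex function is a continuous function of a linear perturbation. -/
lemma exists_continuous_argmin {X : Set (EuclideanSpace ℝ (Fin d))}
    {φ ψ : EuclideanSpace ℝ (Fin d) → ℝ}
    (hφ : ConvexOn ℝ X φ) (hψ : StrongConvexOn X 1 ψ) {c κ : ℝ} (hc : 0 ≤ c) (hκ : 0 < κ) :
    ∃ h : EuclideanSpace ℝ (Fin d) → EuclideanSpace ℝ (Fin d), Continuous h ∧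
      ∀ s, ∀ z ∈ X, IsMinOn (fun x => inner ℝ s x + c * φ x + κ * ψ x) X z → z = h s := by
  classical
  -- A minimizer is not assumed to exist for every s, so the Lipschitz map is built on the set A of
  -- those s that have one and then extended arbitrarily.
  let A : Set (EuclideanSpace ℝ (Fin d)) :=
    {s | ∃ z ∈ X, IsMinOn (fun x => inner ℝ s x + c * φ x + κ * ψ x) X z}
  have hlip : ∀ s s' z z', z ∈ X → z' ∈ X →
      IsMinOn (fun x => inner ℝ s x + c * φ x + κ * ψ x) X z →
      IsMinOn (fun x => inner ℝ s' x + c * φ x + κ * ψ x) X z' →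
      ‖z - z'‖ ≤ κ⁻¹ * ‖s - s'‖ := by
    intro s s' z z' hz hz' hm hm'
    -- Adding the two growth inequalities cancels φ and ψ and leaves κ ‖z - z'‖² ≤ ⟨s - s', z' - z⟩.
    have h1 := strongConvexOn_add_sq_le hφ hψ s hc hκ.le hz hz' hm
    have h2 := strongConvexOn_add_sq_le hφ hψ s' hc hκ.le hz' hz hm'
    rw [norm_sub_rev] at h1
    have h3 : κ * ‖z - z'‖ ^ 2 ≤ inner ℝ (s - s') (z' - z) := by
      rw [inner_sub_left, inner_sub_right, inner_sub_right]
      linarith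
    have h4 := (real_inner_le_norm (s - s') (z' - z))
    rw [norm_sub_rev z' z] at h4
    rw [inv_mul_eq_div, le_div_iff₀ hκ]
    by_contra hlt
    push Not at hlt
    have hpos : 0 < ‖z - z'‖ := by
      by_contra h0
      have : ‖z - z'‖ = 0 := le_antisymm (not_lt.1 h0) (norm_nonneg _)
      rw [this, zero_mul] at hlt
      exact absurd hlt (not_lt.2 (norm_nonneg _))
    nlinarith
  choose! f hfX hfmin using fun s (hs : s ∈ A) => hs
  have hf : LipschitzOnWith (Real.toNNReal κ⁻¹) f A := by
    refine LipschitzOnWith.of_dist_le_mul fun s hs s' hs' => ?_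
    rw [dist_eq_norm, dist_eq_norm, Real.coe_toNNReal _ (by positivity)]
    exact hlip s s' _ _ (hfX s hs) (hfX s' hs') (hfmin s hs) (hfmin s' hs')
  obtain ⟨h, hh, heq⟩ := hf.extend_finite_dimension
  refine ⟨h, hh.continuous, fun s z hz hm => ?_⟩
  have hs : s ∈ A := ⟨z, hz, hm⟩
  rw [← heq hs]
  have := hlip s s z (f s) hz (hfX s hs) hm (hfmin s hs)
  rw [sub_self, norm_zero, mul_zero] at this
  exact sub_eq_zero.1 (norm_le_zero_iff.1 this)

lemma dualAveragingObjective_eq (φ ψ : EuclideanSpace ℝ (Fin d) → ℝ) (L η : ℕ → ℝ)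
    (G : ℕ → EuclideanSpace ℝ (Fin d)) (t : ℕ) :
    dualAveragingObjective φ ψ L η G t
      = fun x => inner ℝ (∑ τ ∈ Finset.range (t + 1), (1 / theta τ) • G τ) x
        + (1 / theta t) ^ 2 * φ x + (L (t + 1) + η (t + 1) / theta (t + 1)) * ψ x := by
  ext x
  rw [dualAveragingObjective, ← Finset.sum_mul, sum_one_div_theta, sum_inner]
  simp_rw [real_inner_smul_left]
  ring

/-- Strong convexity at the midpoint, where ψ is nonnegative. -/
lemma norm_sub_sq_le_of_strongConvexOn {X : Set (EuclideanSpace ℝ (Fin d))}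
    {ψ : EuclideanSpace ℝ (Fin d) → ℝ} (hψ : StrongConvexOn X 1 ψ) (h0 : ∀ w ∈ X, 0 ≤ ψ w)
    {v w : EuclideanSpace ℝ (Fin d)} (hv : v ∈ X) (hw : w ∈ X) :
    ‖v - w‖ ^ 2 ≤ 4 * (ψ v + ψ w) := by
  have h := hψ.2 hv hw (by norm_num : (0 : ℝ) ≤ 1 / 2) (by norm_num : (0 : ℝ) ≤ 1 / 2) (by norm_num)
  have h1 := h0 _ (hψ.1 hv hw (by norm_num : (0 : ℝ) ≤ 1 / 2) (by norm_num : (0 : ℝ) ≤ 1 / 2)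
    (by norm_num))
  simp only [smul_eq_mul] at h
  linarith

end Argmin

/-! ### Accelerated dual averaging along one trajectory. -/

section Path

variable {d : ℕ}

/-- One trajectory of accelerated dual averaging with inexact gradients: `G t` is used in place of
the subgradient `H t` of the smooth function `f t` at `y t`; the functions `f t` decrease to an
approximation of the objective, which takes the value `fstar` at the comparison point `xstar`. -/
structure IsPerturbedPath (X : Set (EuclideanSpace ℝ (Fin d))) (φ ψ : EuclideanSpace ℝ (Fin d) → ℝ)
    (L η : ℕ → ℝ) (f : ℕ → EuclideanSpace ℝ (Fin d) → ℝ) (G H x y z : ℕ → EuclideanSpace ℝ (Fin d))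
    (xstar : EuclideanSpace ℝ (Fin d)) (fstar ε C R : ℝ) : Prop where
  convex : ConvexOn ℝ X φ
  strongConvex : StrongConvexOn X 1 ψ
  nonneg : ∀ w ∈ X, 0 ≤ ψ w
  z_mem : ∀ t, z (t + 1) ∈ X
  z_min : ∀ t, IsMinOn (dualAveragingObjective φ ψ L η G t) X (z (t + 1))
  y_eq : ∀ t, y t = (1 - theta t) • x t + theta t • z t
  x_succ : ∀ t, x (t + 1) = (1 - theta t) • x t + theta t • z (t + 1)
  coeff_mono : ∀ t, L (t + 1) + η (t + 1) / theta (t + 1)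
    ≤ L (t + 2) + η (t + 2) / theta (t + 2)
  coeff_nonneg : ∀ t, 0 ≤ L t + η t / theta t
  eta_pos : ∀ t, 0 < η t
  add_inner_le : ∀ t w, f t (y t) + inner ℝ (H t) (w - y t) ≤ f t w
  descent : ∀ t v, f t (y t + v) ≤ f t (y t) + inner ℝ (H t) v + L t / 2 * ‖v‖ ^ 2
  antitone : ∀ t w, f (t + 1) w ≤ f t w
  le_star : ∀ t, f t xstar ≤ fstar + ε * theta t
  lipschitz_zero : ∀ v w, f 0 v - f 0 w ≤ C * ‖v - w‖
  norm_zero_le : ‖G 0‖ ≤ C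
  coeff_one : C / R ≤ L 1 + η 1 / theta 1
  pos_R : 0 < R
  star_mem : xstar ∈ X
  prox_star : ψ xstar ≤ R ^ 2

namespace IsPerturbedPath

variable {X : Set (EuclideanSpace ℝ (Fin d))} {φ ψ : EuclideanSpace ℝ (Fin d) → ℝ}
    {L η : ℕ → ℝ} {f : ℕ → EuclideanSpace ℝ (Fin d) → ℝ}
    {G H x y z : ℕ → EuclideanSpace ℝ (Fin d)}
    {xstar : EuclideanSpace ℝ (Fin d)} {fstar ε C R : ℝ}

lemma x_mem (h : IsPerturbedPath X φ ψ L η f G H x y z xstar fstar ε C R) (t : ℕ) :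
    x (t + 1) ∈ X := by
  induction t with
  | zero => simpa [h.x_succ, theta] using h.z_mem 0
  | succ t ih =>
    rw [h.x_succ]
    exact h.convex.1 ih (h.z_mem _) (by linarith [theta_le_one (t + 1)]) (theta_pos _).le (by ring)

/-- The noise contributed by step `t` to the convergence estimate. -/
def noise (η : ℕ → ℝ) (G H z : ℕ → EuclideanSpace ℝ (Fin d)) (xstar : EuclideanSpace ℝ (Fin d))
    (t : ℕ) : ℝ :=
  1 / theta t * (-inner ℝ (G t - H t) (z t - xstar)) + 1 / theta t * (‖G t - H t‖ ^ 2 / (2 * η t))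

/-- Quadratic growth of the dual averaging objective. The linear part is recentred at xstar so that
it vanishes for the choice w = xstar. -/
lemma min_add_le (h : IsPerturbedPath X φ ψ L η f G H x y z xstar fstar ε C R) (t : ℕ)
    {w : EuclideanSpace ℝ (Fin d)} (hw : w ∈ X) :
    inner ℝ (∑ τ ∈ Finset.range (t + 1), (1 / theta τ) • G τ) (z (t + 1) - xstar)
      + (1 / theta t) ^ 2 * φ (z (t + 1))
      + (L (t + 1) + η (t + 1) / theta (t + 1)) * ψ (z (t + 1))
      + (L (t + 1) + η (t + 1) / theta (t + 1)) / 2 * ‖w - z (t + 1)‖ ^ 2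
    ≤ inner ℝ (∑ τ ∈ Finset.range (t + 1), (1 / theta τ) • G τ) (w - xstar)
      + (1 / theta t) ^ 2 * φ w + (L (t + 1) + η (t + 1) / theta (t + 1)) * ψ w := by
  have hmin := h.z_min t
  rw [dualAveragingObjective_eq] at hmin
  have := strongConvexOn_add_sq_le h.convex h.strongConvex _ (by positivity)
    (h.coeff_nonneg (t + 1)) (h.z_mem t) hw hmin
  rw [inner_sub_right, inner_sub_right]
  linarith

/-- The start z 0 is arbitrary, so there is no growth inequality to compare it with z 1. Instead the
Lipschitz bounds on f 0 and G 0 leave an error 2C ‖z 1 - xstar‖; its growth in z 1 is absorbed by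
the ψ term, whose coefficient is at least C / R, and 5CR remains. -/
lemma first_step_le (h : IsPerturbedPath X φ ψ L η f G H x y z xstar fstar ε C R) :
    f 0 (x 1) + φ (x 1) ≤ inner ℝ (G 0) (z 1 - xstar) + φ (z 1)
      + (L 1 + η 1 / theta 1) * ψ (z 1) + (fstar + ε) + 5 * C * R := by
  have hx : x 1 = z 1 := by simpa [theta] using h.x_succ 0
  rw [hx]
  have h1 := h.lipschitz_zero (z 1) xstar
  have h2 := h.le_star 0
  simp only [theta, mul_one] at h2
  have hC : 0 ≤ C := (norm_nonneg _).trans h.norm_zero_le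
  have h3 : -(C * ‖z 1 - xstar‖) ≤ inner ℝ (G 0) (z 1 - xstar) := by
    have := (abs_le.1 (abs_real_inner_le_norm (G 0) (z 1 - xstar))).1
    have := mul_le_mul_of_nonneg_right h.norm_zero_le (norm_nonneg (z 1 - xstar))
    linarith
  have h4 := norm_sub_sq_le_of_strongConvexOn h.strongConvex h.nonneg (h.z_mem 0) h.star_mem
  simp only [zero_add] at h4
  have hR := h.pos_R
  -- The weight 4R is chosen so that ‖z 1 - xstar‖² ≤ 4 (ψ (z 1) + R²) produces exactly ψ (z 1) / R;
  -- the 5 is this 4 plus 1 from ψ xstar ≤ R².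
  have h5 : 2 * ‖z 1 - xstar‖ ≤ ‖z 1 - xstar‖ ^ 2 / (4 * R) + 4 * R := by
    have : 0 ≤ (‖z 1 - xstar‖ - 4 * R) ^ 2 / (4 * R) := by positivity
    have h6 : (‖z 1 - xstar‖ - 4 * R) ^ 2 / (4 * R)
        = ‖z 1 - xstar‖ ^ 2 / (4 * R) + 4 * R - 2 * ‖z 1 - xstar‖ := by
      field_simp
      ring
    linarith
  have h6 : ‖z 1 - xstar‖ ^ 2 / (4 * R) ≤ ψ (z 1) / R + R := by
    have hp := h.prox_star
    rw [div_le_iff₀ (by positivity)]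
    have : (ψ (z 1) / R + R) * (4 * R) = 4 * (ψ (z 1) + R ^ 2) := by
      field_simp
    rw [this]
    linarith
  have h7 : C * (2 * ‖z 1 - xstar‖) ≤ C / R * ψ (z 1) + 5 * C * R := by
    have := mul_le_mul_of_nonneg_left (h5.trans (add_le_add_left h6 _)) hC
    have h8 : C * (ψ (z 1) / R + R + 4 * R) = C / R * ψ (z 1) + 5 * C * R := by ring
    linarith
  have h8 := mul_le_mul_of_nonneg_right h.coeff_one (h.nonneg _ (h.z_mem 0))
  simp only [zero_add] at h8
  linarith

/-- Descent at y, the subgradient inequality towards the old x and towards xstar, and convexity of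
φ, multiplied by 1/θ². The curvature and the Young terms combine to half the regularization
coefficient of the previous minimization, which is why that objective already uses the index t + 1.
-/
lemma step_le (h : IsPerturbedPath X φ ψ L η f G H x y z xstar fstar ε C R) (t : ℕ) :
    (1 / theta (t + 1)) ^ 2 * (f (t + 1) (x (t + 2)) + φ (x (t + 2)))
      ≤ (1 / theta t) ^ 2 * (f t (x (t + 1)) + φ (x (t + 1)))
        + 1 / theta (t + 1) * (fstar + ε * theta (t + 1)
          + inner ℝ (G (t + 1)) (z (t + 2) - xstar) + φ (z (t + 2)))
        + (L (t + 1) + η (t + 1) / theta (t + 1)) / 2 * ‖z (t + 2) - z (t + 1)‖ ^ 2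
        + noise η G H z xstar (t + 1) := by
  have hθ := theta_pos (t + 1)
  have hθ1 := theta_le_one (t + 1)
  have hη := h.eta_pos (t + 1)
  have hA := one_sub_theta_succ t
  have hxy : x (t + 2) = y (t + 1) + theta (t + 1) • (z (t + 2) - z (t + 1)) := by
    rw [h.x_succ, h.y_eq]
    module
  -- The displacement splits into directions towards x (t + 1) and xstar, where the subgradient
  -- inequality applies, and a remainder on which H is exchanged for G.
  have hxy' : theta (t + 1) • (z (t + 2) - z (t + 1))
      = (1 - theta (t + 1)) • (x (t + 1) - y (t + 1))
        + theta (t + 1) • ((xstar - y (t + 1)) + (z (t + 2) - xstar)) := by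
    rw [h.y_eq]
    module
  have h1 := h.descent (t + 1) (theta (t + 1) • (z (t + 2) - z (t + 1)))
  rw [← hxy, norm_smul, Real.norm_of_nonneg hθ.le, mul_pow, hxy', inner_add_right,
    real_inner_smul_right, real_inner_smul_right, inner_add_right] at h1
  have h2 := h.add_inner_le (t + 1) (x (t + 1))
  have h3 := h.add_inner_le (t + 1) xstar
  have h4 := h.le_star (t + 1)
  have h5 := h.antitone t (x (t + 1))
  have h6 : φ (x (t + 2)) ≤ (1 - theta (t + 1)) * φ (x (t + 1)) + theta (t + 1) * φ (z (t + 2)) := by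
    rw [h.x_succ (t + 1)]
    exact h.convex.2 (h.x_mem t) (h.z_mem (t + 1)) (by linarith) hθ.le (by ring)
  -- The error is paired with z (t + 1), which does not depend on the current samples and so gives
  -- mean zero, and with an increment that Young's inequality handles.
  have hinner : inner ℝ (H (t + 1)) (z (t + 2) - xstar)
      = inner ℝ (G (t + 1)) (z (t + 2) - xstar)
        - inner ℝ (G (t + 1) - H (t + 1)) (z (t + 1) - xstar)
        - inner ℝ (G (t + 1) - H (t + 1)) (z (t + 2) - z (t + 1)) := by
    rw [show z (t + 2) - xstar = (z (t + 1) - xstar) + (z (t + 2) - z (t + 1)) by abel]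
    simp only [inner_sub_left, inner_add_right]
    ring
  have hyoung : -inner ℝ (G (t + 1) - H (t + 1)) (z (t + 2) - z (t + 1))
      ≤ η (t + 1) / 2 * ‖z (t + 2) - z (t + 1)‖ ^ 2
        + ‖G (t + 1) - H (t + 1)‖ ^ 2 / (2 * η (t + 1)) := by
    have h7 := (abs_le.1 (abs_real_inner_le_norm (G (t + 1) - H (t + 1))
      (z (t + 2) - z (t + 1)))).1
    have h8 : 0 ≤ (η (t + 1) * ‖z (t + 2) - z (t + 1)‖ - ‖G (t + 1) - H (t + 1)‖) ^ 2
        / (2 * η (t + 1)) := by positivity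
    have h9 : (η (t + 1) * ‖z (t + 2) - z (t + 1)‖ - ‖G (t + 1) - H (t + 1)‖) ^ 2
        / (2 * η (t + 1)) = η (t + 1) / 2 * ‖z (t + 2) - z (t + 1)‖ ^ 2
        + ‖G (t + 1) - H (t + 1)‖ ^ 2 / (2 * η (t + 1))
        - ‖G (t + 1) - H (t + 1)‖ * ‖z (t + 2) - z (t + 1)‖ := by
      field_simp
      ring
    linarith
  have hupper : f (t + 1) (x (t + 2)) + φ (x (t + 2))
      ≤ (1 - theta (t + 1)) * (f t (x (t + 1)) + φ (x (t + 1)))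
        + theta (t + 1) * (fstar + ε * theta (t + 1)
          + inner ℝ (G (t + 1)) (z (t + 2) - xstar) + φ (z (t + 2))
          - inner ℝ (G (t + 1) - H (t + 1)) (z (t + 1) - xstar)
          + η (t + 1) / 2 * ‖z (t + 2) - z (t + 1)‖ ^ 2
          + ‖G (t + 1) - H (t + 1)‖ ^ 2 / (2 * η (t + 1)))
        + L (t + 1) / 2 * (theta (t + 1) ^ 2 * ‖z (t + 2) - z (t + 1)‖ ^ 2) := by
    have h7 := mul_le_mul_of_nonneg_left (h2.trans h5) (sub_nonneg.2 hθ1)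
    have h8 := mul_le_mul_of_nonneg_left (h3.trans h4) hθ.le
    have h9 := mul_le_mul_of_nonneg_left hyoung hθ.le
    rw [hinner] at h1
    linarith
  have hmul := mul_le_mul_of_nonneg_left hupper (by positivity : 0 ≤ (1 / theta (t + 1)) ^ 2)
  refine hmul.trans (le_of_eq ?_)
  have hinv : 1 / theta (t + 1) * theta (t + 1) = 1 := by field_simp
  have hdiv : η (t + 1) / theta (t + 1) = η (t + 1) * (1 / theta (t + 1)) := by ring
  rw [noise, hdiv]
  generalize 1 / theta (t + 1) = a at *
  generalize theta (t + 1) = b at *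
  rw [← hA]
  set Q := fstar + ε * b + inner ℝ (G (t + 1)) (z (t + 2) - xstar) + φ (z (t + 2)) with hQ
  generalize ‖z (t + 2) - z (t + 1)‖ = n
  generalize inner ℝ (G (t + 1) - H (t + 1)) (z (t + 1) - xstar) = q
  generalize ‖G (t + 1) - H (t + 1)‖ ^ 2 / (2 * η (t + 1)) = r
  linear_combination (a * (Q - q + η (t + 1) / 2 * n ^ 2 + r)
    + L (t + 1) / 2 * n ^ 2 * (a * b + 1)) * hinv

/-- The right side carries the minimal value of the dual averaging objective, recentred at xstar. In
the induction, growth at z (t + 1) evaluated at z (t + 2) supplies the square of the increment that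
the step needs. -/
lemma sum_le (h : IsPerturbedPath X φ ψ L η f G H x y z xstar fstar ε C R) (t : ℕ) :
    (1 / theta t) ^ 2 * (f t (x (t + 1)) + φ (x (t + 1)))
      ≤ inner ℝ (∑ τ ∈ Finset.range (t + 1), (1 / theta τ) • G τ) (z (t + 1) - xstar)
        + (1 / theta t) ^ 2 * φ (z (t + 1))
        + (L (t + 1) + η (t + 1) / theta (t + 1)) * ψ (z (t + 1))
        + ((1 / theta t) ^ 2 * fstar + (t + 1) * ε) + 5 * C * R
        + ∑ τ ∈ Finset.range t, noise η G H z xstar (τ + 1) := by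
  induction t with
  | zero =>
    have := h.first_step_le
    have h0 : theta 0 = 1 := rfl
    simpa [h0] using this
  | succ t ih =>
    have hstep := h.step_le t
    have hmin := h.min_add_le t (h.z_mem (t + 1))
    have hcoef := mul_le_mul_of_nonneg_right (h.coeff_mono t) (h.nonneg _ (h.z_mem (t + 1)))
    rw [Finset.sum_range_succ _ (t + 1), 
      Finset.sum_range_succ (fun τ => noise η G H z xstar (τ + 1)) t, inner_add_left,
      real_inner_smul_left]
    have hsq := one_div_theta_succ_sq t
    have hinv : 1 / theta (t + 1) * theta (t + 1) = 1 := by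
      have := (theta_pos (t + 1)).ne'
      field_simp
    have hexp : 1 / theta (t + 1) * (fstar + ε * theta (t + 1)
          + inner ℝ (G (t + 1)) (z (t + 2) - xstar) + φ (z (t + 2)))
        = 1 / theta (t + 1) * fstar + ε
          + 1 / theta (t + 1) * inner ℝ (G (t + 1)) (z (t + 2) - xstar)
          + 1 / theta (t + 1) * φ (z (t + 2)) := by
      linear_combination ε * hinv
    rw [hexp] at hstep
    have e1 : (1 / theta (t + 1)) ^ 2 * φ (z (t + 1 + 1))
        = (1 / theta t) ^ 2 * φ (z (t + 2)) + 1 / theta (t + 1) * φ (z (t + 2)) := by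
      rw [hsq, add_mul]
    have e2 : (1 / theta (t + 1)) ^ 2 * fstar
        = (1 / theta t) ^ 2 * fstar + 1 / theta (t + 1) * fstar := by
      rw [hsq, add_mul]
    rw [e1, e2]
    push_cast
    simp only [add_assoc, one_add_one_eq_two] at *
    linarith

/-- The convergence estimate along one trajectory. -/
theorem objective_le (h : IsPerturbedPath X φ ψ L η f G H x y z xstar fstar ε C R) (t : ℕ) :
    (1 / theta t) ^ 2 * (f t (x (t + 1)) + φ (x (t + 1)))
      ≤ (1 / theta t) ^ 2 * (fstar + φ xstar) + (t + 1) * ε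
        + (L (t + 1) + η (t + 1) / theta (t + 1)) * R ^ 2 + 5 * C * R
        + ∑ τ ∈ Finset.range t, noise η G H z xstar (τ + 1) := by
  have h1 := h.sum_le t
  -- Comparing the minimal value with the value at xstar removes the accumulated gradients.
  have h2 := h.min_add_le t h.star_mem
  have h3 := mul_le_mul_of_nonneg_left h.prox_star (h.coeff_nonneg (t + 1))
  rw [sub_self, inner_zero_right] at h2
  have h4 : 0 ≤ (L (t + 1) + η (t + 1) / theta (t + 1)) / 2 * ‖xstar - z (t + 1)‖ ^ 2 :=
    mul_nonneg (div_nonneg (h.coeff_nonneg _) two_pos.le) (sq_nonneg _)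
  linarith

end IsPerturbedPath

end Path

/-! ### Mean and variance of the stochastic gradient error. -/

section Noise

variable {d m : ℕ} {Ω Ξ : Type*} [MeasurableSpace Ξ]

lemma aestronglyMeasurable_comp_measurable {α β : Type*} {𝒢 _mΩ : MeasurableSpace Ω} {μ : Measure Ω}
    [TopologicalSpace α] [TopologicalSpace.PseudoMetrizableSpace α] [MeasurableSpace α]
    [BorelSpace α] [TopologicalSpace β] [TopologicalSpace.PseudoMetrizableSpace β]
    [SecondCountableTopology β] [MeasurableSpace β] [OpensMeasurableSpace β]
    {Φ : α → β} (hΦ : Measurable Φ) {y : Ω → α} (hy : AEStronglyMeasurable[𝒢] y μ) :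
    AEStronglyMeasurable[𝒢] (fun ω => Φ (y ω)) μ := by
  obtain ⟨y', hy', heq⟩ := hy
  refine ⟨fun ω => Φ (y' ω), ?_, heq.fun_comp Φ⟩
  exact (hΦ.comp hy'.measurable).stronglyMeasurable

namespace IsGradientSelection

variable {𝒢 mΩ : MeasurableSpace Ω} {μ : Measure Ω} [IsProbabilityMeasure μ]
  {F : EuclideanSpace ℝ (Fin d) → Ξ → ℝ} {P : Measure Ξ} [IsProbabilityMeasure P] {C : ℝ}
  {Γ : EuclideanSpace ℝ (Fin d) → Ξ → EuclideanSpace ℝ (Fin d)}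
  {D : Set (EuclideanSpace ℝ (Fin d) × Ξ)}

lemma measurable_smoothedGradient (h : IsGradientSelection F P C Γ D) (u : ℝ) :
    Measurable (smoothedGradient Γ P u) := by
  have hm : Measurable fun q : EuclideanSpace ℝ (Fin d) × (EuclideanSpace ℝ (Fin d) × Ξ) =>
      Γ (q.1 + u • q.2.1) q.2.2 :=
    h.measurable.comp (by fun_prop : Measurable
      fun q : EuclideanSpace ℝ (Fin d) × (EuclideanSpace ℝ (Fin d) × Ξ) =>
        (q.1 + u • q.2.1, q.2.2))
  exact (hm.stronglyMeasurable.integral_prod_right'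
    (ν := (stdGaussian (EuclideanSpace ℝ (Fin d))).prod P)).measurable

lemma ae_prod_mem (h : IsGradientSelection F P C Γ D) {u : ℝ} (hu : u ≠ 0)
    {β : Type*} [MeasurableSpace β] (ν : Measure β) [SFinite ν]
    {y : β → EuclideanSpace ℝ (Fin d)} (hy : Measurable y) :
    ∀ᵐ q ∂ν.prod ((stdGaussian (EuclideanSpace ℝ (Fin d))).prod P),
      (y q.1 + u • q.2.1, q.2.2) ∈ D := by
  have hm : MeasurableSet {q : β × (EuclideanSpace ℝ (Fin d) × Ξ) |
      (y q.1 + u • q.2.1, q.2.2) ∈ D} := by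
    have : Measurable fun q : β × (EuclideanSpace ℝ (Fin d) × Ξ) =>
        (y q.1 + u • q.2.1, q.2.2) := by fun_prop
    exact this h.measurableSet
  rw [Measure.ae_prod_iff_ae_ae hm]
  exact Filter.Eventually.of_forall fun b => h.ae_mem (y b) u hu

lemma map_prodMk_of_indep (h𝒢 : 𝒢 ≤ mΩ)
    {β : Type*} [MeasurableSpace β] {Y : Ω → β} (hY : Measurable[𝒢] Y)
    {α : Type*} [MeasurableSpace α] {W : Ω → α} (hW : Measurable W)
    (hind : Indep 𝒢 (MeasurableSpace.comap W inferInstance) μ) :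
    μ.map (fun ω => (Y ω, W ω)) = (μ.map Y).prod (μ.map W) := by
  refine (indepFun_iff_map_prod_eq_prod_map_map (hY.mono h𝒢 le_rfl).aemeasurable
    hW.aemeasurable).1 ?_
  rw [IndepFun_iff_Indep]
  exact indep_of_indep_of_le_left hind hY.comap_le

/-- A query point that depends only on independent information almost surely hits a point of
differentiability. -/
lemma ae_mem_of_indep (h : IsGradientSelection F P C Γ D) {u : ℝ} (hu : u ≠ 0)
    (h𝒢 : 𝒢 ≤ mΩ) {W : Ω → EuclideanSpace ℝ (Fin d) × Ξ}
    (hW : Measurable W) (hlaw : μ.map W = (stdGaussian (EuclideanSpace ℝ (Fin d))).prod P)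
    (hind : Indep 𝒢 (MeasurableSpace.comap W inferInstance) μ)
    {y : Ω → EuclideanSpace ℝ (Fin d)} (hy : AEStronglyMeasurable[𝒢] y μ) :
    ∀ᵐ ω ∂μ, (y ω + u • (W ω).1, (W ω).2) ∈ D := by
  obtain ⟨y', hy', heq⟩ := hy
  have hmap := map_prodMk_of_indep (μ := μ) h𝒢 hy'.measurable hW hind
  have hm : Measurable fun ω => (y' ω, W ω) := (hy'.mono h𝒢).measurable.prodMk hW
  have hae := h.ae_prod_mem hu (μ.map y') measurable_id
  rw [← hlaw, ← hmap] at hae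
  filter_upwards [ae_of_ae_map hm.aemeasurable hae, heq] with ω hω hyω
  rw [hyω]
  exact hω

/-- The stochastic gradient is unbiased: its error is orthogonal to independent vectors. -/
lemma integral_inner_error_eq_zero (h : IsGradientSelection F P C Γ D) {u : ℝ} (hu : u ≠ 0)
    (h𝒢 : 𝒢 ≤ mΩ) {W : Ω → EuclideanSpace ℝ (Fin d) × Ξ}
    (hW : Measurable W) (hlaw : μ.map W = (stdGaussian (EuclideanSpace ℝ (Fin d))).prod P)
    (hind : Indep 𝒢 (MeasurableSpace.comap W inferInstance) μ)
    {y v : Ω → EuclideanSpace ℝ (Fin d)} (hy : AEStronglyMeasurable[𝒢] y μ)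
    (hv : AEStronglyMeasurable[𝒢] v μ) {B : ℝ} (hB : ∀ᵐ ω ∂μ, ‖v ω‖ ≤ B) :
    ∫ ω, inner ℝ (Γ (y ω + u • (W ω).1) (W ω).2 - smoothedGradient Γ P u (y ω)) (v ω) ∂μ = 0 := by
  -- With 𝒢-measurable versions of y and v, the pair (y', v') is independent of W. The joint law is
  -- a product, and Fubini reduces the claim to fixed y' and v', where the error has mean zero by
  -- definition of `smoothedGradient`.
  obtain ⟨y', hy', hyeq⟩ := hy
  obtain ⟨v', hv', hveq⟩ := hv
  have hYm : Measurable[𝒢] fun ω => (y' ω, v' ω) := hy'.measurable.prodMk hv'.measurable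
  have hmap := map_prodMk_of_indep (μ := μ) h𝒢 hYm hW hind
  rw [hlaw] at hmap
  have hYm0 : Measurable fun ω => (y' ω, v' ω) := hYm.mono h𝒢 le_rfl
  have hprob : IsProbabilityMeasure (μ.map fun ω => (y' ω, v' ω)) :=
    Measure.isProbabilityMeasure_map hYm0.aemeasurable
  have hm : Measurable fun ω => ((y' ω, v' ω), W ω) := hYm0.prodMk hW
  let Φ : (EuclideanSpace ℝ (Fin d) × EuclideanSpace ℝ (Fin d)) × (EuclideanSpace ℝ (Fin d) × Ξ)
    → ℝ := fun q => inner ℝ (Γ (q.1.1 + u • q.2.1) q.2.2 - smoothedGradient Γ P u q.1.1) q.1.2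
  have hΦm : Measurable Φ := by
    have h1 : Measurable fun q : (EuclideanSpace ℝ (Fin d) × EuclideanSpace ℝ (Fin d)) ×
        (EuclideanSpace ℝ (Fin d) × Ξ) => Γ (q.1.1 + u • q.2.1) q.2.2 :=
      h.measurable.comp (by fun_prop : Measurable
        fun q : (EuclideanSpace ℝ (Fin d) × EuclideanSpace ℝ (Fin d)) ×
        (EuclideanSpace ℝ (Fin d) × Ξ) => (q.1.1 + u • q.2.1, q.2.2))
    have h2 : Measurable fun q : (EuclideanSpace ℝ (Fin d) × EuclideanSpace ℝ (Fin d)) ×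
        (EuclideanSpace ℝ (Fin d) × Ξ) => smoothedGradient Γ P u q.1.1 :=
      (h.measurable_smoothedGradient u).comp (measurable_fst.comp measurable_fst)
    exact (h1.sub h2).inner (measurable_snd.comp measurable_fst)
  have hvb : ∀ᵐ q ∂μ.map (fun ω => (y' ω, v' ω)), ‖q.2‖ ≤ B := by
    rw [ae_map_iff hYm0.aemeasurable (measurableSet_le (by fun_prop) (by fun_prop))]
    filter_upwards [hB, hveq] with ω h1 h2
    rwa [← h2]
  have hΦb : ∀ᵐ q ∂(μ.map fun ω => (y' ω, v' ω)).prod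
      ((stdGaussian (EuclideanSpace ℝ (Fin d))).prod P), ‖Φ q‖ ≤ (C + C) * B := by
    have hfst := (Measure.quasiMeasurePreserving_fst (μ := μ.map fun ω => (y' ω, v' ω))
      (ν := (stdGaussian (EuclideanSpace ℝ (Fin d))).prod P)).ae hvb
    filter_upwards [h.ae_prod_mem hu (μ.map fun ω => (y' ω, v' ω)) measurable_fst, hfst]
      with q hq hqB
    have h1 := h.norm_le _ hq
    have h2 := h.norm_smoothedGradient_le q.1.1 hu
    refine (norm_inner_le_norm _ _).trans ?_
    exact mul_le_mul ((norm_sub_le _ _).trans (add_le_add h1 h2)) hqB (norm_nonneg _)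
      (by have := h.nonneg; positivity)
  have hint : Integrable Φ ((μ.map fun ω => (y' ω, v' ω)).prod
      ((stdGaussian (EuclideanSpace ℝ (Fin d))).prod P)) :=
    Integrable.of_bound hΦm.aestronglyMeasurable _ hΦb
  have hzero : ∀ q : EuclideanSpace ℝ (Fin d) × EuclideanSpace ℝ (Fin d),
      ∫ p, Φ (q, p) ∂((stdGaussian (EuclideanSpace ℝ (Fin d))).prod P) = 0 := by
    intro q
    have hi := h.integrable_gradient q.1 hu
    simp only [Φ]
    simp_rw [real_inner_comm q.2]
    have hi' : Integrable (fun p : EuclideanSpace ℝ (Fin d) × Ξ =>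
        Γ (q.1 + u • p.1) p.2 - smoothedGradient Γ P u q.1)
        ((stdGaussian (EuclideanSpace ℝ (Fin d))).prod P) := hi.sub (integrable_const _)
    rw [integral_inner hi', integral_sub hi (integrable_const _)]
    simp [smoothedGradient]
  calc ∫ ω, inner ℝ (Γ (y ω + u • (W ω).1) (W ω).2 - smoothedGradient Γ P u (y ω)) (v ω) ∂μ
      = ∫ ω, Φ ((y' ω, v' ω), W ω) ∂μ := by
        refine integral_congr_ae ?_
        filter_upwards [hyeq, hveq] with ω h1 h2
        simp only [Φ, h1, h2]
    _ = ∫ q, Φ q ∂(μ.map fun ω => ((y' ω, v' ω), W ω)) :=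
        (integral_map hm.aemeasurable hΦm.aestronglyMeasurable).symm
    _ = 0 := by
        rw [hmap, integral_prod _ hint]
        simp [hzero]

end IsGradientSelection

/-- A family of jointly independent measurable samples with law `N(0, I) ⊗ P`. -/
structure IsMeasurableSampling [MeasurableSpace Ω] (μ : Measure Ω) (P : Measure Ξ)
    (W : ℕ × Fin m → Ω → EuclideanSpace ℝ (Fin d) × Ξ) : Prop where
  measurable : ∀ p, Measurable (W p)
  map_eq : ∀ p, μ.map (W p) = (stdGaussian (EuclideanSpace ℝ (Fin d))).prod P
  iIndepFun : iIndepFun W μ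

/-- The information contained in the samples with index in `S`. -/
@[reducible]
def sampleInfo (W : ℕ × Fin m → Ω → EuclideanSpace ℝ (Fin d) × Ξ) (S : Set (ℕ × Fin m)) :
    MeasurableSpace Ω :=
  ⨆ p ∈ S, MeasurableSpace.comap (W p) inferInstance

lemma sampleInfo_mono (W : ℕ × Fin m → Ω → EuclideanSpace ℝ (Fin d) × Ξ)
    {S S' : Set (ℕ × Fin m)} (h : S ⊆ S') : sampleInfo W S ≤ sampleInfo W S' :=
  biSup_mono h

lemma measurable_sampleInfo (W : ℕ × Fin m → Ω → EuclideanSpace ℝ (Fin d) × Ξ)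
    {S : Set (ℕ × Fin m)} {p : ℕ × Fin m} (hp : p ∈ S) : Measurable[sampleInfo W S] (W p) :=
  Measurable.mono (comap_measurable (W p))
    (le_biSup (fun p => MeasurableSpace.comap (W p) inferInstance) hp) le_rfl

namespace IsMeasurableSampling

variable [mΩ : MeasurableSpace Ω] {μ : Measure Ω} [IsProbabilityMeasure μ]
  {P : Measure Ξ} [IsProbabilityMeasure P] {W : ℕ × Fin m → Ω → EuclideanSpace ℝ (Fin d) × Ξ}

omit [IsProbabilityMeasure μ] [IsProbabilityMeasure P] in
lemma sampleInfo_le (hW : IsMeasurableSampling μ P W) (S : Set (ℕ × Fin m)) :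
    sampleInfo W S ≤ mΩ :=
  iSup₂_le fun p _ => (hW.measurable p).comap_le

omit [IsProbabilityMeasure μ] [IsProbabilityMeasure P] in
lemma indep (hW : IsMeasurableSampling μ P W) {S : Set (ℕ × Fin m)} {p : ℕ × Fin m}
    (hp : p ∉ S) : Indep (sampleInfo W S) (MeasurableSpace.comap (W p) inferInstance) μ := by
  have := indep_iSup_of_disjoint (fun p => (hW.measurable p).comap_le) hW.iIndepFun.iIndep
    (Set.disjoint_singleton_right.2 hp)
  simpa [sampleInfo] using this

variable {F : EuclideanSpace ℝ (Fin d) → Ξ → ℝ} {C : ℝ}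
  {Γ : EuclideanSpace ℝ (Fin d) → Ξ → EuclideanSpace ℝ (Fin d)}
  {D : Set (EuclideanSpace ℝ (Fin d) × Ξ)}

/-- The error of the stochastic gradient computed from the sample `w` at the query point `y`. -/
def gradientError (Γ : EuclideanSpace ℝ (Fin d) → Ξ → EuclideanSpace ℝ (Fin d)) (P : Measure Ξ)
    (u : ℝ) (y : EuclideanSpace ℝ (Fin d)) (w : EuclideanSpace ℝ (Fin d) × Ξ) :
    EuclideanSpace ℝ (Fin d) :=
  Γ (y + u • w.1) w.2 - smoothedGradient Γ P u y

omit [IsProbabilityMeasure μ] [IsProbabilityMeasure P] in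
lemma aestronglyMeasurable_gradient (h : IsGradientSelection F P C Γ D) (u : ℝ)
    {y : Ω → EuclideanSpace ℝ (Fin d)} {S : Set (ℕ × Fin m)}
    (hy : AEStronglyMeasurable[sampleInfo W S] y μ) {p : ℕ × Fin m} (hp : p ∈ S) :
    AEStronglyMeasurable[sampleInfo W S] (fun ω => Γ (y ω + u • (W p ω).1) (W p ω).2) μ := by
  obtain ⟨y', hy', heq⟩ := hy
  have hWp := measurable_sampleInfo W hp
  refine ⟨fun ω => Γ (y' ω + u • (W p ω).1) (W p ω).2, ?_, ?_⟩
  · refine Measurable.stronglyMeasurable ?_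
    exact h.measurable.comp ((hy'.measurable.add (hWp.fst.const_smul u)).prodMk hWp.snd)
  · filter_upwards [heq] with ω hω
    rw [hω]

omit [IsProbabilityMeasure μ] in
lemma aestronglyMeasurable_gradientError (h : IsGradientSelection F P C Γ D) (u : ℝ)
    {y : Ω → EuclideanSpace ℝ (Fin d)} {S : Set (ℕ × Fin m)}
    (hy : AEStronglyMeasurable[sampleInfo W S] y μ) {p : ℕ × Fin m} (hp : p ∈ S) :
    AEStronglyMeasurable[sampleInfo W S] (fun ω => gradientError Γ P u (y ω) (W p ω)) μ :=
  (aestronglyMeasurable_gradient h u hy hp).sub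
    (aestronglyMeasurable_comp_measurable (h.measurable_smoothedGradient u) hy)

lemma ae_norm_gradientError_le (hW : IsMeasurableSampling μ P W)
    (h : IsGradientSelection F P C Γ D) {u : ℝ} (hu : u ≠ 0)
    {y : Ω → EuclideanSpace ℝ (Fin d)} {S : Set (ℕ × Fin m)}
    (hy : AEStronglyMeasurable[sampleInfo W S] y μ) {p : ℕ × Fin m} (hp : p ∉ S) :
    ∀ᵐ ω ∂μ, ‖gradientError Γ P u (y ω) (W p ω)‖ ≤ C + C := by
  filter_upwards [h.ae_mem_of_indep hu (hW.sampleInfo_le S) (hW.measurable p) (hW.map_eq p)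
    (hW.indep hp) hy] with ω hω
  have h1 : ‖Γ (y ω + u • (W p ω).1) (W p ω).2‖ ≤ C :=
    h.norm_le (y ω + u • (W p ω).1, (W p ω).2) hω
  exact (norm_sub_le _ _).trans (add_le_add h1 (h.norm_smoothedGradient_le _ hu))

omit [IsProbabilityMeasure μ] in
lemma aestronglyMeasurable_gradientError' (hW : IsMeasurableSampling μ P W)
    (h : IsGradientSelection F P C Γ D) (u : ℝ)
    {y : Ω → EuclideanSpace ℝ (Fin d)} {S : Set (ℕ × Fin m)}
    (hy : AEStronglyMeasurable[sampleInfo W S] y μ) (p : ℕ × Fin m) :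
    AEStronglyMeasurable (fun ω => gradientError Γ P u (y ω) (W p ω)) μ :=
  (aestronglyMeasurable_gradientError h u (hy.mono (sampleInfo_mono W (Set.subset_univ S)))
    (Set.mem_univ p)).mono (hW.sampleInfo_le _)

lemma integrable_inner_gradientError (hW : IsMeasurableSampling μ P W)
    (h : IsGradientSelection F P C Γ D) {u : ℝ} (hu : u ≠ 0)
    {y v : Ω → EuclideanSpace ℝ (Fin d)} {S : Set (ℕ × Fin m)}
    (hy : AEStronglyMeasurable[sampleInfo W S] y μ) {p : ℕ × Fin m} (hp : p ∉ S)
    (hv : AEStronglyMeasurable v μ) {B : ℝ} (hB : ∀ᵐ ω ∂μ, ‖v ω‖ ≤ B) :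
    Integrable (fun ω => inner ℝ (gradientError Γ P u (y ω) (W p ω)) (v ω)) μ := by
  refine Integrable.of_bound ((hW.aestronglyMeasurable_gradientError' h u hy p).inner hv)
    ((C + C) * B) ?_
  filter_upwards [hW.ae_norm_gradientError_le h hu hy hp, hB] with ω h1 h2
  exact (norm_inner_le_norm _ _).trans
    (mul_le_mul h1 h2 (norm_nonneg _) (by have := h.nonneg; positivity))

lemma integral_inner_gradientError (hW : IsMeasurableSampling μ P W)
    (h : IsGradientSelection F P C Γ D) {u : ℝ} (hu : u ≠ 0)
    {y v : Ω → EuclideanSpace ℝ (Fin d)} {S : Set (ℕ × Fin m)}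
    (hy : AEStronglyMeasurable[sampleInfo W S] y μ) {p : ℕ × Fin m} (hp : p ∉ S)
    (hv : AEStronglyMeasurable[sampleInfo W S] v μ) {B : ℝ} (hB : ∀ᵐ ω ∂μ, ‖v ω‖ ≤ B) :
    ∫ ω, inner ℝ (gradientError Γ P u (y ω) (W p ω)) (v ω) ∂μ = 0 :=
  h.integral_inner_error_eq_zero hu (hW.sampleInfo_le S) (hW.measurable p) (hW.map_eq p)
    (hW.indep hp) hy hv hB

/-- A variance is at most the second moment: expanding ‖error + mean‖² ≤ C² leaves a cross term that
integrates to zero. This gives C² instead of the pointwise 4C². -/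
lemma integral_norm_sq_gradientError_le (hW : IsMeasurableSampling μ P W)
    (h : IsGradientSelection F P C Γ D) {u : ℝ} (hu : u ≠ 0)
    {y : Ω → EuclideanSpace ℝ (Fin d)} {S : Set (ℕ × Fin m)}
    (hy : AEStronglyMeasurable[sampleInfo W S] y μ) {p : ℕ × Fin m} (hp : p ∉ S) :
    ∫ ω, inner ℝ (gradientError Γ P u (y ω) (W p ω)) (gradientError Γ P u (y ω) (W p ω)) ∂μ
      ≤ C ^ 2 := by
  have hG : AEStronglyMeasurable[sampleInfo W S] (fun ω => smoothedGradient Γ P u (y ω)) μ :=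
    aestronglyMeasurable_comp_measurable (h.measurable_smoothedGradient u) hy
  have hGb : ∀ᵐ ω ∂μ, ‖smoothedGradient Γ P u (y ω)‖ ≤ C :=
    Filter.Eventually.of_forall fun ω => h.norm_smoothedGradient_le _ hu
  have hi := hW.integrable_inner_gradientError h hu hy hp (hG.mono (hW.sampleInfo_le S)) hGb
  have h0 := hW.integral_inner_gradientError h hu hy hp hG hGb
  have hsq := hW.integrable_inner_gradientError h hu hy hp
    (hW.aestronglyMeasurable_gradientError' h u hy p) (hW.ae_norm_gradientError_le h hu hy hp)
  calc _ ≤ ∫ ω, (C ^ 2 - 2 * inner ℝ (gradientError Γ P u (y ω) (W p ω))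
        (smoothedGradient Γ P u (y ω))) ∂μ := by
        refine integral_mono_ae hsq ((integrable_const _).sub (hi.const_mul 2)) ?_
        filter_upwards [h.ae_mem_of_indep hu (hW.sampleInfo_le S) (hW.measurable p) (hW.map_eq p)
          (hW.indep hp) hy] with ω hω
        have h1 : ‖Γ (y ω + u • (W p ω).1) (W p ω).2‖ ≤ C :=
          h.norm_le (y ω + u • (W p ω).1, (W p ω).2) hω
        have h2 := norm_add_sq_real (gradientError Γ P u (y ω) (W p ω))
          (smoothedGradient Γ P u (y ω))
        have h3 : gradientError Γ P u (y ω) (W p ω) + smoothedGradient Γ P u (y ω)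
          = Γ (y ω + u • (W p ω).1) (W p ω).2 := sub_add_cancel _ _
        rw [h3] at h2
        have h4 := sq_nonneg ‖smoothedGradient Γ P u (y ω)‖
        have h5 := pow_le_pow_left₀ (norm_nonneg _) h1 2
        rw [real_inner_self_eq_norm_sq]
        linarith
    _ = C ^ 2 := by
        rw [integral_sub (integrable_const _) (hi.const_mul 2), integral_const_mul, h0]
        simp

/-- Averaging `m` independent stochastic gradients divides the variance by `m`. -/
lemma integral_norm_sq_average_le (hm : 1 ≤ m) (hW : IsMeasurableSampling μ P W)
    (h : IsGradientSelection F P C Γ D) {u : ℝ} (hu : u ≠ 0)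
    {y : Ω → EuclideanSpace ℝ (Fin d)} {t : ℕ}
    (hy : AEStronglyMeasurable[sampleInfo W {p | p.1 < t}] y μ) :
    ∫ ω, ‖(1 / (m : ℝ)) • ∑ i, gradientError Γ P u (y ω) (W (t, i) ω)‖ ^ 2 ∂μ ≤ C ^ 2 / m := by
  have hm0 : (0 : ℝ) < m := by exact_mod_cast hm
  have hnot : ∀ i : Fin m, (t, i) ∉ {p : ℕ × Fin m | p.1 < t} := fun i => by simp
  have hexp : ∀ ω, ‖(1 / (m : ℝ)) • ∑ i, gradientError Γ P u (y ω) (W (t, i) ω)‖ ^ 2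
      = (1 / (m : ℝ)) ^ 2 * ∑ i, ∑ j, inner ℝ (gradientError Γ P u (y ω) (W (t, i) ω))
        (gradientError Γ P u (y ω) (W (t, j) ω)) := fun ω => by
    rw [norm_smul, mul_pow, Real.norm_of_nonneg (by positivity), ← real_inner_self_eq_norm_sq,
      sum_inner]
    simp_rw [inner_sum]
  simp_rw [hexp]
  have hint : ∀ i j : Fin m, Integrable (fun ω => inner ℝ (gradientError Γ P u (y ω) (W (t, i) ω))
        (gradientError Γ P u (y ω) (W (t, j) ω))) μ := fun i j =>
    hW.integrable_inner_gradientError h hu hy (hnot i)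
      (hW.aestronglyMeasurable_gradientError' h u hy _) (hW.ae_norm_gradientError_le h hu hy (hnot j))
  -- Regard sample j as known too: the error of j then depends only on known samples, from which
  -- sample i is independent.
  have hcross : ∀ i j : Fin m, i ≠ j → ∫ ω, inner ℝ (gradientError Γ P u (y ω) (W (t, i) ω))
        (gradientError Γ P u (y ω) (W (t, j) ω)) ∂μ = 0 := fun i j hij => by
    have hsub : {p : ℕ × Fin m | p.1 < t} ⊆ insert (t, j) {p : ℕ × Fin m | p.1 < t} :=
      Set.subset_insert _ _
    have hnot' : (t, i) ∉ insert (t, j) {p : ℕ × Fin m | p.1 < t} := by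
      simp [hij]
    exact hW.integral_inner_gradientError h hu (hy.mono (sampleInfo_mono W hsub)) hnot'
      (aestronglyMeasurable_gradientError h u (hy.mono (sampleInfo_mono W hsub))
        (Set.mem_insert _ _)) (hW.ae_norm_gradientError_le h hu hy (hnot j))
  rw [integral_const_mul, integral_finsetSum _ fun i _ => integrable_finsetSum _ fun j _ => hint i j]
  simp_rw [integral_finsetSum _ fun j _ => hint _ j]
  have hdiag : ∑ i : Fin m, ∑ j : Fin m, ∫ ω, inner ℝ (gradientError Γ P u (y ω) (W (t, i) ω))
        (gradientError Γ P u (y ω) (W (t, j) ω)) ∂μ ≤ ∑ _i : Fin m, C ^ 2 := by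
    refine Finset.sum_le_sum fun i _ => ?_
    rw [Finset.sum_eq_single i (fun j _ hj => hcross i j hj.symm) (by simp)]
    exact hW.integral_norm_sq_gradientError_le h hu hy (hnot i)
  rw [Finset.sum_const, Finset.card_univ, Fintype.card_fin, nsmul_eq_mul] at hdiag
  calc _ ≤ (1 / (m : ℝ)) ^ 2 * (m * C ^ 2) := by gcongr
    _ = C ^ 2 / m := by field_simp

end IsMeasurableSampling

end Noise

/-! ### Adaptedness and boundedness of the iterates. -/

section Adapted

variable {d m : ℕ} {Ω Ξ : Type*} [MeasurableSpace Ξ] [mΩ : MeasurableSpace Ω] {μ : Measure Ω}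
  {W : ℕ × Fin m → Ω → EuclideanSpace ℝ (Fin d) × Ξ}

/-- The given samples are only almost everywhere measurable; measurable versions ensure that the
σ-algebras they generate lie in the ambient one. -/
lemma IsGaussianSampling.exists_measurableSampling {P : Measure Ξ}
    {Z : ℕ → Fin m → Ω → EuclideanSpace ℝ (Fin d)} {ξ : ℕ → Fin m → Ω → Ξ}
    (h : IsGaussianSampling μ P Z ξ) :
    ∃ W : ℕ × Fin m → Ω → EuclideanSpace ℝ (Fin d) × Ξ, IsMeasurableSampling μ P W ∧
      ∀ t i, ∀ᵐ ω ∂μ, W (t, i) ω = (Z t i ω, ξ t i ω) := by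
  have hae : ∀ p : ℕ × Fin m, AEMeasurable (fun ω => (Z p.1 p.2 ω, ξ p.1 p.2 ω)) μ :=
    fun p => (h.hasLaw p.1 p.2).aemeasurable
  refine ⟨fun p => (hae p).mk, ⟨fun p => (hae p).measurable_mk, fun p => ?_, ?_⟩, fun t i => ?_⟩
  · rw [← (h.hasLaw p.1 p.2).map_eq]
    exact Measure.map_congr (hae p).ae_eq_mk.symm
  · exact h.iIndepFun.congr fun p => (hae p).ae_eq_mk
  · exact (hae (t, i)).ae_eq_mk.symm

/-- `f` is almost surely bounded and depends only on the samples drawn before time `t`. -/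
def IsAdaptedBounded (W : ℕ × Fin m → Ω → EuclideanSpace ℝ (Fin d) × Ξ) (μ : Measure Ω) (t : ℕ)
    (f : Ω → EuclideanSpace ℝ (Fin d)) : Prop :=
  AEStronglyMeasurable[sampleInfo W {p | p.1 < t}] f μ ∧ ∃ B : ℝ, ∀ᵐ ω ∂μ, ‖f ω‖ ≤ B

namespace IsAdaptedBounded

variable {t : ℕ} {f f' : Ω → EuclideanSpace ℝ (Fin d)}

lemma const (v : EuclideanSpace ℝ (Fin d)) : IsAdaptedBounded W μ t fun _ => v :=
  ⟨aestronglyMeasurable_const, ‖v‖, Filter.Eventually.of_forall fun _ => le_rfl⟩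

lemma add (hf : IsAdaptedBounded W μ t f) (hf' : IsAdaptedBounded W μ t f') :
    IsAdaptedBounded W μ t fun ω => f ω + f' ω := by
  obtain ⟨h1, B, hB⟩ := hf
  obtain ⟨h1', B', hB'⟩ := hf'
  refine ⟨h1.add h1', B + B', ?_⟩
  filter_upwards [hB, hB'] with ω h h'
  exact (norm_add_le _ _).trans (add_le_add h h')

lemma const_smul (hf : IsAdaptedBounded W μ t f) (c : ℝ) :
    IsAdaptedBounded W μ t fun ω => c • f ω := by
  obtain ⟨h1, B, hB⟩ := hf
  refine ⟨h1.const_smul c, |c| * B, ?_⟩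
  filter_upwards [hB] with ω h
  rw [norm_smul, Real.norm_eq_abs]
  gcongr

lemma sum {ι : Type*} (s : Finset ι) {f : ι → Ω → EuclideanSpace ℝ (Fin d)}
    (hf : ∀ i ∈ s, IsAdaptedBounded W μ t (f i)) :
    IsAdaptedBounded W μ t fun ω => ∑ i ∈ s, f i ω := by
  classical
  induction s using Finset.induction_on with
  | empty => simpa using const 0
  | insert i s hi ih =>
    simp_rw [Finset.sum_insert hi]
    exact (hf i (Finset.mem_insert_self i s)).add
      (ih fun j hj => hf j (Finset.mem_insert_of_mem hj))

lemma mono (hf : IsAdaptedBounded W μ t f) {t' : ℕ} (h : t ≤ t') : IsAdaptedBounded W μ t' f :=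
  ⟨hf.1.mono (sampleInfo_mono W fun _ hp => lt_of_lt_of_le hp h), hf.2⟩

lemma congr (hf : IsAdaptedBounded W μ t f) (h : ∀ᵐ ω ∂μ, f ω = f' ω) :
    IsAdaptedBounded W μ t f' := by
  obtain ⟨h1, B, hB⟩ := hf
  refine ⟨h1.congr h, B, ?_⟩
  filter_upwards [hB, h] with ω h1 h2
  rwa [← h2]

/-- Boundedness survives because closed balls in finite dimension are compact. -/
lemma continuous_comp (hf : IsAdaptedBounded W μ t f)
    {Φ : EuclideanSpace ℝ (Fin d) → EuclideanSpace ℝ (Fin d)} (hΦ : Continuous Φ) :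
    IsAdaptedBounded W μ t fun ω => Φ (f ω) := by
  obtain ⟨h1, B, hB⟩ := hf
  obtain ⟨B', hB'⟩ := (isCompact_closedBall (0 : EuclideanSpace ℝ (Fin d)) B).exists_bound_of_continuousOn
    hΦ.continuousOn
  refine ⟨hΦ.comp_aestronglyMeasurable h1, B', ?_⟩
  filter_upwards [hB] with ω h
  exact hB' _ (by simpa using h)

lemma aestronglyMeasurable {P : Measure Ξ} (hf : IsAdaptedBounded W μ t f)
    (hW : IsMeasurableSampling μ P W) : AEStronglyMeasurable f μ :=
  hf.1.mono (hW.sampleInfo_le _)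

end IsAdaptedBounded

variable {P : Measure Ξ} [IsProbabilityMeasure P] [IsProbabilityMeasure μ]
  {F : EuclideanSpace ℝ (Fin d) → Ξ → ℝ} {C : ℝ}
  {Γ : EuclideanSpace ℝ (Fin d) → Ξ → EuclideanSpace ℝ (Fin d)}
  {D : Set (EuclideanSpace ℝ (Fin d) × Ξ)}
  {X : Set (EuclideanSpace ℝ (Fin d))} {φ ψ : EuclideanSpace ℝ (Fin d) → ℝ} {u L η : ℕ → ℝ}
  {x₀ z₀ : EuclideanSpace ℝ (Fin d)} {Z : ℕ → Fin m → Ω → EuclideanSpace ℝ (Fin d)}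
  {ξ : ℕ → Fin m → Ω → Ξ} {g : ℕ → Fin m → Ω → EuclideanSpace ℝ (Fin d)}
  {x y z : ℕ → Ω → EuclideanSpace ℝ (Fin d)}

namespace IsRun

/-- The oracle has no choice: its answers are almost surely the selected gradients. -/
lemma ae_oracle_eq (hrun : IsRun μ F X φ ψ u L η x₀ z₀ Z ξ g x y z)
    (hsel : IsGradientSelection F P C Γ D) (hW : IsMeasurableSampling μ P W)
    (hWeq : ∀ t i, ∀ᵐ ω ∂μ, W (t, i) ω = (Z t i ω, ξ t i ω)) {t : ℕ} (hu : u t ≠ 0)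
    (hy : IsAdaptedBounded W μ t (y t)) (i : Fin m) :
    ∀ᵐ ω ∂μ, g t i ω = Γ (y t ω + u t • (W (t, i) ω).1) (W (t, i) ω).2 ∧ ‖g t i ω‖ ≤ C := by
  have hnot : (t, i) ∉ {p : ℕ × Fin m | p.1 < t} := by simp
  filter_upwards [hsel.ae_mem_of_indep hu (hW.sampleInfo_le _) (hW.measurable (t, i))
    (hW.map_eq (t, i)) (hW.indep hnot) hy.1, hWeq t i, hrun.oracle t i] with ω hD hω hg
  have hsub := hsel.subdifferential_eq _ hD
  have hnorm := hsel.norm_le _ hD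
  rw [hω] at hsub hnorm ⊢
  dsimp only at hsub hnorm ⊢
  rw [hsub, Set.mem_singleton_iff] at hg
  exact ⟨hg, hg ▸ hnorm⟩

lemma adapted_oracle (hrun : IsRun μ F X φ ψ u L η x₀ z₀ Z ξ g x y z)
    (hsel : IsGradientSelection F P C Γ D) (hW : IsMeasurableSampling μ P W)
    (hWeq : ∀ t i, ∀ᵐ ω ∂μ, W (t, i) ω = (Z t i ω, ξ t i ω)) {t : ℕ} (hu : u t ≠ 0)
    (hy : IsAdaptedBounded W μ t (y t)) (i : Fin m) : IsAdaptedBounded W μ (t + 1) (g t i) := by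
  have hae := hrun.ae_oracle_eq hsel hW hWeq hu hy i
  refine ⟨?_, C, by filter_upwards [hae] with ω h using h.2⟩
  have h1 := IsMeasurableSampling.aestronglyMeasurable_gradient hsel (u t)
    (hy.mono t.le_succ).1 (p := (t, i)) (by simp)
  refine h1.congr ?_
  filter_upwards [hae] with ω h using h.1.symm

/-- Measurability is forced: past samples fix y, almost sure uniqueness of the subgradient then
fixes g, and uniqueness of the minimizer fixes z as a continuous function of the accumulated
gradient. Boundedness propagates by the same steps. -/
lemma adapted (hrun : IsRun μ F X φ ψ u L η x₀ z₀ Z ξ g x y z)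
    (hsel : IsGradientSelection F P C Γ D) (hW : IsMeasurableSampling μ P W)
    (hWeq : ∀ t i, ∀ᵐ ω ∂μ, W (t, i) ω = (Z t i ω, ξ t i ω)) (hu : ∀ t, u t ≠ 0)
    (hφ : ConvexOn ℝ X φ) (hψ : StrongConvexOn X 1 ψ) (hκ : ∀ t, 0 < L t + η t / theta t) (t : ℕ) :
    IsAdaptedBounded W μ t (x t) ∧ IsAdaptedBounded W μ t (z t) ∧
      IsAdaptedBounded W μ t (y t) ∧
      IsAdaptedBounded W μ t
        (fun ω => ∑ τ ∈ Finset.range t, (1 / theta τ) • averageGradient g τ ω) := by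
  have hyt : ∀ t, IsAdaptedBounded W μ t (x t) → IsAdaptedBounded W μ t (z t) →
      IsAdaptedBounded W μ t (y t) := fun t hx hz => by
    rw [show y t = fun ω => (1 - theta t) • x t ω + theta t • z t ω from
      funext fun ω => hrun.y_eq t ω]
    exact (hx.const_smul _).add (hz.const_smul _)
  induction t with
  | zero =>
    have hx : IsAdaptedBounded W μ 0 (x 0) := by
      rw [show x 0 = fun _ => x₀ from funext hrun.x_zero]
      exact .const _
    have hz : IsAdaptedBounded W μ 0 (z 0) := by
      rw [show z 0 = fun _ => z₀ from funext hrun.z_zero]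
      exact .const _
    exact ⟨hx, hz, hyt 0 hx hz, by simpa using IsAdaptedBounded.const 0⟩
  | succ t ih =>
    obtain ⟨hx, hz, hy, hS⟩ := ih
    have hG : IsAdaptedBounded W μ (t + 1) (averageGradient g t) :=
      (IsAdaptedBounded.sum Finset.univ fun i _ =>
        hrun.adapted_oracle hsel hW hWeq (hu t) hy i).const_smul _
    have hS' : IsAdaptedBounded W μ (t + 1)
        (fun ω => ∑ τ ∈ Finset.range (t + 1), (1 / theta τ) • averageGradient g τ ω) := by
      simp_rw [Finset.sum_range_succ]
      exact (hS.mono t.le_succ).add (hG.const_smul _)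
    obtain ⟨Φ, hΦc, hΦ⟩ := exists_continuous_argmin hφ hψ (c := (1 / theta t) ^ 2)
      (by positivity) (hκ (t + 1))
    have hz' : IsAdaptedBounded W μ (t + 1) (z (t + 1)) := by
      refine (hS'.continuous_comp hΦc).congr (Filter.Eventually.of_forall fun ω => ?_)
      refine (hΦ _ _ (hrun.z_mem t ω) ?_).symm
      have := hrun.z_min t ω
      rwa [dualAveragingObjective_eq] at this
    have hx' : IsAdaptedBounded W μ (t + 1) (x (t + 1)) := by
      rw [show x (t + 1) = fun ω => (1 - theta t) • x t ω + theta t • z (t + 1) ω from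
        funext fun ω => hrun.x_succ t ω]
      exact ((hx.mono t.le_succ).const_smul _).add (hz'.const_smul _)
    exact ⟨hx', hz', hyt _ hx' hz', hS'⟩

lemma ae_error_eq (hm : 1 ≤ m) (hrun : IsRun μ F X φ ψ u L η x₀ z₀ Z ξ g x y z)
    (hsel : IsGradientSelection F P C Γ D) (hW : IsMeasurableSampling μ P W)
    (hWeq : ∀ t i, ∀ᵐ ω ∂μ, W (t, i) ω = (Z t i ω, ξ t i ω)) {t : ℕ} (hu : u t ≠ 0)
    (hy : IsAdaptedBounded W μ t (y t)) :
    ∀ᵐ ω ∂μ, averageGradient g t ω - smoothedGradient Γ P (u t) (y t ω)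
      = (1 / (m : ℝ)) • ∑ i, IsMeasurableSampling.gradientError Γ P (u t) (y t ω) (W (t, i) ω) := by
  have hm0 : (m : ℝ) ≠ 0 := by exact_mod_cast (by omega : m ≠ 0)
  have hall : ∀ᵐ ω ∂μ, ∀ i, g t i ω = Γ (y t ω + u t • (W (t, i) ω).1) (W (t, i) ω).2 :=
    ae_all_iff.2 fun i => by
      filter_upwards [hrun.ae_oracle_eq hsel hW hWeq hu hy i] with ω h using h.1
  filter_upwards [hall] with ω hω
  simp only [averageGradient, IsMeasurableSampling.gradientError, Finset.sum_sub_distrib, hω,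
    Finset.sum_const, Finset.card_univ, Fintype.card_fin, smul_sub]
  rw [← Nat.cast_smul_eq_nsmul ℝ, smul_smul, one_div_mul_cancel hm0, one_smul]

/-- The noise of step `t` is integrable, with the mean controlled by the variance alone. -/
lemma integral_noise_le (hm : 1 ≤ m) (hrun : IsRun μ F X φ ψ u L η x₀ z₀ Z ξ g x y z)
    (hsel : IsGradientSelection F P C Γ D) (hW : IsMeasurableSampling μ P W)
    (hWeq : ∀ t i, ∀ᵐ ω ∂μ, W (t, i) ω = (Z t i ω, ξ t i ω)) {t : ℕ} (hu : u t ≠ 0)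
    (hη : 0 < η t) (hy : IsAdaptedBounded W μ t (y t)) (hz : IsAdaptedBounded W μ t (z t))
    (xstar : EuclideanSpace ℝ (Fin d)) :
    Integrable (fun ω => IsPerturbedPath.noise η (fun τ => averageGradient g τ ω)
      (fun τ => smoothedGradient Γ P (u τ) (y τ ω)) (fun τ => z τ ω) xstar t) μ ∧
    ∫ ω, IsPerturbedPath.noise η (fun τ => averageGradient g τ ω)
      (fun τ => smoothedGradient Γ P (u τ) (y τ ω)) (fun τ => z τ ω) xstar t ∂μ
      ≤ 1 / theta t * (C ^ 2 / m / (2 * η t)) := by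
  have hnot : ∀ i : Fin m, (t, i) ∉ {p : ℕ × Fin m | p.1 < t} := fun i => by simp
  let e : Ω → EuclideanSpace ℝ (Fin d) := fun ω =>
    (1 / (m : ℝ)) • ∑ i, IsMeasurableSampling.gradientError Γ P (u t) (y t ω) (W (t, i) ω)
  have hv : IsAdaptedBounded W μ t fun ω => z t ω - xstar := by
    simpa [sub_eq_add_neg] using hz.add (IsAdaptedBounded.const (-xstar))
  obtain ⟨B, hB⟩ := hv.2
  have hinner : ∀ ω, inner ℝ (e ω) (z t ω - xstar) = (1 / (m : ℝ)) * ∑ i, inner ℝ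
      (IsMeasurableSampling.gradientError Γ P (u t) (y t ω) (W (t, i) ω)) (z t ω - xstar) :=
    fun ω => by rw [real_inner_smul_left, sum_inner]
  have hi1 : ∀ i : Fin m, Integrable (fun ω => inner ℝ (IsMeasurableSampling.gradientError Γ P
      (u t) (y t ω) (W (t, i) ω)) (z t ω - xstar)) μ := fun i =>
    hW.integrable_inner_gradientError hsel hu hy.1 (hnot i) (hv.aestronglyMeasurable hW) hB
  have hint1 : Integrable (fun ω => inner ℝ (e ω) (z t ω - xstar)) μ := by
    simp_rw [hinner]
    exact (integrable_finsetSum _ fun i _ => hi1 i).const_mul _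
  have hzero : ∫ ω, inner ℝ (e ω) (z t ω - xstar) ∂μ = 0 := by
    simp_rw [hinner]
    rw [integral_const_mul, integral_finsetSum _ fun i _ => hi1 i,
      Finset.sum_eq_zero fun i _ => hW.integral_inner_gradientError hsel hu hy.1 (hnot i) hv.1 hB,
      mul_zero]
  have heB : ∃ B' : ℝ, ∀ᵐ ω ∂μ, ‖e ω‖ ≤ B' := by
    have hall : ∀ᵐ ω ∂μ, ∀ i, ‖IsMeasurableSampling.gradientError Γ P (u t) (y t ω) (W (t, i) ω)‖
        ≤ C + C := ae_all_iff.2 fun i => hW.ae_norm_gradientError_le hsel hu hy.1 (hnot i)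
    refine ⟨|1 / (m : ℝ)| * ∑ _i : Fin m, (C + C), ?_⟩
    filter_upwards [hall] with ω hω
    rw [norm_smul, Real.norm_eq_abs]
    gcongr
    exact (norm_sum_le _ _).trans (Finset.sum_le_sum fun i _ => hω i)
  obtain ⟨B', hB'⟩ := heB
  have hem : AEStronglyMeasurable e μ :=
    AEStronglyMeasurable.const_smul (Finset.aestronglyMeasurable_fun_sum _ fun i _ =>
      hW.aestronglyMeasurable_gradientError' hsel (u t) hy.1 (t, i)) (1 / (m : ℝ))
  have hint2 : Integrable (fun ω => ‖e ω‖ ^ 2) μ := by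
    refine Integrable.of_bound (hem.norm.pow 2) (B' ^ 2) ?_
    filter_upwards [hB'] with ω hω
    rw [Real.norm_of_nonneg (by positivity)]
    exact pow_le_pow_left₀ (norm_nonneg _) hω 2
  have hvar : ∫ ω, ‖e ω‖ ^ 2 ∂μ ≤ C ^ 2 / m := hW.integral_norm_sq_average_le hm hsel hu hy.1
  have hnoise : ∀ᵐ ω ∂μ, 1 / theta t * (-inner ℝ (e ω) (z t ω - xstar))
      + 1 / theta t * (‖e ω‖ ^ 2 / (2 * η t))
      = IsPerturbedPath.noise η (fun τ => averageGradient g τ ω)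
      (fun τ => smoothedGradient Γ P (u τ) (y τ ω)) (fun τ => z τ ω) xstar t := by
    filter_upwards [hrun.ae_error_eq hm hsel hW hWeq hu hy] with ω hω
    rw [IsPerturbedPath.noise, hω]
  have hint1' : Integrable (fun ω => 1 / theta t * (-inner ℝ (e ω) (z t ω - xstar))) μ :=
    hint1.neg.const_mul _
  have hint2' : Integrable (fun ω => 1 / theta t * (‖e ω‖ ^ 2 / (2 * η t))) μ :=
    (hint2.div_const _).const_mul _
  refine ⟨(hint1'.add hint2').congr hnoise, ?_⟩
  rw [← integral_congr_ae hnoise, integral_add hint1' hint2', integral_const_mul, integral_const_mul, integral_neg, hzero,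
    integral_div, neg_zero, mul_zero, zero_add]
  have := one_div_theta_pos t
  gcongr

end IsRun

end Adapted

/-! ### Numerical estimates for the rate. -/

section Rate

/-- With a = 1/θ_t and b = 1/θ_{t+1}, everything follows from a² = b (b - 1), a ≥ (t + 2) / 2 and b
≥ (t + 3) / 2. The bound D ≥ 1 lets the constant 5 of the first step join the D terms. -/
lemma coeff_le_rate {t : ℕ} (ht : 3 ≤ t) {D : ℝ} (hD : 1 ≤ D) :
    ((t : ℝ) + 1) * D + 1 / theta (t + 1) * D + 5
      ≤ (1 / theta t) ^ 2 * (10 * D / ((t : ℝ) + 1)) := by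
  have ht' : (3 : ℝ) ≤ t := by exact_mod_cast ht
  have ha := one_add_half_le_one_div_theta t
  have hb := one_add_half_le_one_div_theta (t + 1)
  have hsq := one_div_theta_succ_sq t
  push_cast at hb
  generalize 1 / theta t = a at *
  generalize 1 / theta (t + 1) = b at *
  have hT : (0 : ℝ) < (t : ℝ) + 1 := by linarith
  rw [← mul_div_assoc, le_div_iff₀ hT]
  have h1 : b * ((t : ℝ) + 1) ≤ 2 * a ^ 2 := by nlinarith
  have h2 : ((t : ℝ) + 1) ^ 2 + 5 * ((t : ℝ) + 1) ≤ 8 * a ^ 2 := by nlinarith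
  have h3 : ((t : ℝ) + 1 + b + 5) * ((t : ℝ) + 1) ≤ 10 * a ^ 2 := by nlinarith
  have h4 : 5 * ((t : ℝ) + 1) ≤ 5 * ((t : ℝ) + 1) * D := by nlinarith
  nlinarith

lemma noise_coeff_le_rate {t : ℕ} (ht : 3 ≤ t) :
    1 / theta (t + 1) * √((t : ℝ) + 2) + ((t : ℝ) + 1) * √((t : ℝ) + 1) / 2
      ≤ (1 / theta t) ^ 2 * (5 / √((t : ℝ) + 1)) := by
  have ht' : (3 : ℝ) ≤ t := by exact_mod_cast ht
  have ha := one_add_half_le_one_div_theta t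
  have hb := one_add_half_le_one_div_theta (t + 1)
  have hsq := one_div_theta_succ_sq t
  push_cast at hb
  generalize 1 / theta t = a at *
  generalize 1 / theta (t + 1) = b at *
  have hT : (0 : ℝ) < (t : ℝ) + 1 := by linarith
  have hs : 0 < √((t : ℝ) + 1) := Real.sqrt_pos.2 hT
  have hss : √((t : ℝ) + 1) * √((t : ℝ) + 1) = (t : ℝ) + 1 := Real.mul_self_sqrt hT.le
  have hprod : √((t : ℝ) + 2) * √((t : ℝ) + 1) ≤ (t : ℝ) + 3 / 2 := by
    rw [← Real.sqrt_mul (by linarith)]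
    refine Real.sqrt_le_iff.2 ⟨by linarith, by nlinarith⟩
  rw [← mul_div_assoc, le_div_iff₀ hs]
  have h1 : b * ((t : ℝ) + 1) ≤ 2 * a ^ 2 := by nlinarith
  have h2 : ((t : ℝ) + 1) * ((t : ℝ) + 1) ≤ 4 * a ^ 2 := by nlinarith
  have hb0 : 0 < b := by linarith
  have h3 := mul_le_mul_of_nonneg_left hprod hb0.le
  -- Here a² = b (b - 1), and t ≥ 3 gives b ≥ 3.
  have h4 : 4 * b ≤ 2 * a ^ 2 := by nlinarith
  calc (b * √((t : ℝ) + 2) + ((t : ℝ) + 1) * √((t : ℝ) + 1) / 2) * √((t : ℝ) + 1)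
      = b * (√((t : ℝ) + 2) * √((t : ℝ) + 1))
        + ((t : ℝ) + 1) * (√((t : ℝ) + 1) * √((t : ℝ) + 1)) / 2 := by ring
    _ ≤ a ^ 2 * 5 := by
        rw [hss]
        linarith

end Rate

/-! ### Integrability of the regularizer along the iterates. -/

section Integrability

variable {d : ℕ} {Ω : Type*} [MeasurableSpace Ω] {μ : Measure Ω} [IsProbabilityMeasure μ]
  {X : Set (EuclideanSpace ℝ (Fin d))} {φ : EuclideanSpace ℝ (Fin d) → ℝ}

lemma measurable_indicator_of_lowerSemicontinuousOn (hX : IsClosed X)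
    (hφ : LowerSemicontinuousOn φ X) : Measurable (X.indicator φ) := by
  refine measurable_of_Iic fun c => ?_
  obtain ⟨v, hv, heq⟩ := lowerSemicontinuousOn_iff_preimage_Iic.1 hφ c
  have hset : X.indicator φ ⁻¹' Set.Iic c = (X ∩ v) ∪ (Xᶜ ∩ {_w | (0 : ℝ) ≤ c}) := by
    rw [← heq]
    ext w
    by_cases hw : w ∈ X <;> simp [hw]
  rw [hset]
  exact (hX.measurableSet.inter hv.measurableSet).union
    (hX.measurableSet.compl.inter (MeasurableSet.const _))

/-- A closed function of a bounded random point of `X` is integrable once it is bounded above by an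
integrable random variable. -/
lemma integrable_comp_of_lowerSemicontinuousOn (hX : IsClosed X) (hφ : LowerSemicontinuousOn φ X)
    {x : Ω → EuclideanSpace ℝ (Fin d)} (hx : AEStronglyMeasurable x μ) (hmem : ∀ ω, x ω ∈ X)
    {B : ℝ} (hB : ∀ᵐ ω ∂μ, ‖x ω‖ ≤ B) {U : Ω → ℝ} (hU : Integrable U μ)
    (hle : ∀ᵐ ω ∂μ, φ (x ω) ≤ U ω) : Integrable (fun ω => φ (x ω)) μ := by
  have hm : AEStronglyMeasurable (fun ω => φ (x ω)) μ := by
    have h := ((measurable_indicator_of_lowerSemicontinuousOn hX hφ).comp_aemeasurable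
      hx.aemeasurable).aestronglyMeasurable
    refine h.congr (Filter.Eventually.of_forall fun ω => ?_)
    simp [Set.indicator_of_mem (hmem ω)]
  have hcompact : IsCompact (X ∩ Metric.closedBall 0 B) :=
    (isCompact_closedBall _ _).inter_left hX
  -- Lower semicontinuity bounds φ below on compact sets; no upper bound is available there, hence
  -- the integrable majorant U.
  obtain ⟨b, hb⟩ := (hφ.mono Set.inter_subset_left).bddBelow_of_isCompact hcompact
  refine ((integrable_const |b|).add hU.abs).mono' hm ?_
  filter_upwards [hB, hle] with ω h1 h2
  have h3 : b ≤ φ (x ω) := hb ⟨x ω, ⟨hmem ω, by simpa using h1⟩, rfl⟩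
  rw [Real.norm_eq_abs, Pi.add_apply, abs_le]
  constructor
  · linarith [neg_abs_le b, abs_nonneg (U ω)]
  · linarith [le_abs_self (U ω), abs_nonneg b]

end Integrability

lemma norm_averageGradient_le {d m : ℕ} {Ω : Type*} (hm : 1 ≤ m)
    {g : ℕ → Fin m → Ω → EuclideanSpace ℝ (Fin d)} {t : ℕ} {ω : Ω} {C : ℝ}
    (h : ∀ i, ‖g t i ω‖ ≤ C) : ‖averageGradient g t ω‖ ≤ C := by
  have hm0 : (0 : ℝ) < m := by exact_mod_cast hm
  rw [averageGradient, norm_smul, Real.norm_of_nonneg (by positivity), one_div, inv_mul_le_iff₀ hm0]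
  refine (norm_sum_le _ _).trans ((Finset.sum_le_sum fun i _ => h i).trans_eq ?_)
  simp

/-- The total coefficient `L_t + η_t / θ_t` of the regularizer increases with `t`. -/
lemma coeff_mono_of_eq {L₀ ub c : ℝ} (hL₀ : 0 < L₀) (hub : 0 < ub) (hc : 0 < c) {u L η : ℕ → ℝ}
    (hu : ∀ t, u t = theta t * ub) (hL : ∀ t, L t = L₀ / u t)
    (hη : ∀ t, η t = L₀ * √((t : ℝ) + 1) / c) (t : ℕ) :
    L t + η t / theta t ≤ L (t + 1) + η (t + 1) / theta (t + 1) := by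
  have h1 := theta_succ_le t
  have h2 := theta_pos t
  have h3 := theta_pos (t + 1)
  rw [hL, hL, hu, hu, hη, hη]
  push_cast
  gcongr
  linarith

end RandomizedSmoothing

end

/-! ### The convergence theorem: pathwise estimate, expectation and rate. -/

open RandomizedSmoothing

theorem corollary2 {d m T : ℕ} (hd : 1 ≤ d) (hm : 1 ≤ m) (hT : 4 ≤ T)
    {L₀ R : ℝ} (hL₀ : 0 < L₀) (hR : 0 < R)
    {Ω Ξ : Type*} [MeasurableSpace Ω] [MeasurableSpace Ξ]
    (μ : Measure Ω) [IsProbabilityMeasure μ] (P : Measure Ξ) [IsProbabilityMeasure P]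
    -- the problem: feasible set, random functions, regularizer
    (X : Set (EuclideanSpace ℝ (Fin d))) (hX_closed : IsClosed X) (hX_convex : Convex ℝ X)
    (F : EuclideanSpace ℝ (Fin d) → Ξ → ℝ) (hF_meas : Measurable (Function.uncurry F))
    (hF_int : ∀ w, Integrable (F w) P)
    (hF_lip : ∀ᵐ s ∂P, ∀ v w, |F v s - F w s| ≤ L₀ * ‖v - w‖)
    (hf_convex : ConvexOn ℝ Set.univ (RandomizedSmoothing.expectedObjective F P))
    (φ : EuclideanSpace ℝ (Fin d) → ℝ) (hφ_convex : ConvexOn ℝ X φ)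
    (hφ_closed : LowerSemicontinuousOn φ X)
    -- the proximal function
    (ψ : EuclideanSpace ℝ (Fin d) → ℝ) (hψ_nonneg : ∀ w ∈ X, 0 ≤ ψ w)
    (hψ_convex : StrongConvexOn X 1 ψ)
    -- the parameters of the method
    (u L η : ℕ → ℝ)
    (hu : ∀ t, u t = RandomizedSmoothing.theta t * (R * (d : ℝ) ^ (-(1 / 4) : ℝ)))
    (hL : ∀ t, L t = L₀ / u t)
    (hη : ∀ t, η t = L₀ * √((t : ℝ) + 1) / (R * √(m : ℝ)))
    -- the samples and the iterates
    (Z : ℕ → Fin m → Ω → EuclideanSpace ℝ (Fin d)) (ξ : ℕ → Fin m → Ω → Ξ)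
    (hsample : RandomizedSmoothing.IsGaussianSampling μ P Z ξ)
    (x₀ z₀ : EuclideanSpace ℝ (Fin d)) (hx₀ : x₀ ∈ X) (hz₀ : z₀ ∈ X)
    (g : ℕ → Fin m → Ω → EuclideanSpace ℝ (Fin d))
    (x y z : ℕ → Ω → EuclideanSpace ℝ (Fin d))
    (hrun : RandomizedSmoothing.IsRun μ F X φ ψ u L η x₀ z₀ Z ξ g x y z)
    -- the comparison point
    (xstar : EuclideanSpace ℝ (Fin d)) (hxstar : xstar ∈ X) (hψ_xstar : ψ xstar ≤ R ^ 2) :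
    Integrable (fun ω => RandomizedSmoothing.expectedObjective F P (x T ω) + φ (x T ω)) μ ∧
    (∫ ω, (RandomizedSmoothing.expectedObjective F P (x T ω) + φ (x T ω)) ∂μ)
        - (RandomizedSmoothing.expectedObjective F P xstar + φ xstar)
      ≤ 10 * L₀ * R * (d : ℝ) ^ (1 / 4 : ℝ) / T + 5 * L₀ * R / √((T : ℝ) * m) := by
  have hd1 : (1 : ℝ) ≤ d := by exact_mod_cast hd
  have hm0 : (0 : ℝ) < m := by exact_mod_cast hm
  have hsm : 0 < √(m : ℝ) := Real.sqrt_pos.2 hm0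
  set D : ℝ := (d : ℝ) ^ (1 / 4 : ℝ) with hDdef
  have hD1 : 1 ≤ D := Real.one_le_rpow hd1 (by norm_num)
  have hDsq : √(d : ℝ) = D * D := by
    rw [Real.sqrt_eq_rpow, hDdef, ← Real.rpow_add (by linarith)]
    norm_num
  have hDinv : (d : ℝ) ^ (-(1 / 4) : ℝ) = D⁻¹ := Real.rpow_neg (by linarith) _
  rw [hDinv] at hu
  have hub : 0 < R * D⁻¹ := by positivity
  have hu0 : ∀ t, 0 < u t := fun t => by
    rw [hu]
    exact mul_pos (theta_pos t) hub
  have hη0 : ∀ t, 0 < η t := fun t => by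
    rw [hη]
    positivity
  have hL0 : ∀ t, 0 < L t := fun t => by
    rw [hL]
    exact div_pos hL₀ (hu0 t)
  have hκ0 : ∀ t, 0 < L t + η t / theta t := fun t =>
    add_pos (hL0 t) (div_pos (hη0 t) (theta_pos t))
  obtain ⟨W, hW, hWeq⟩ := hsample.exists_measurableSampling
  -- As θ₀ = 1, the first query centre is deterministic, so the gradient selection can be built from
  -- it before anything is known about measurability of the iterates.
  have hy₀ : ∀ ω, y 0 ω = z₀ := fun ω => by
    rw [hrun.y_eq, hrun.z_zero]
    simp [theta]
  obtain ⟨Γ, E, hΓ, hE, hsub, hnorm, hae⟩ := exists_gradient_selection hF_meas hL₀.le hF_lip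
    (hsample.hasLaw 0 ⟨0, hm⟩) z₀ (hu0 0).ne' (by
      filter_upwards [hrun.oracle 0 ⟨0, hm⟩] with ω hω
      rw [hy₀] at hω
      exact ⟨_, hω⟩)
  have hsel : IsGradientSelection F P L₀ Γ E :=
    ⟨hF_meas, hF_int, hF_lip, hΓ, hE, hsub, hnorm, hae⟩
  have hlip := hsel.abs_expectedObjective_sub_le
  have hadapt := hrun.adapted hsel hW hWeq (fun t => (hu0 t).ne') hφ_convex hψ_convex hκ0
  have hg₀ : ∀ᵐ ω ∂μ, ∀ i, ‖g 0 i ω‖ ≤ L₀ := ae_all_iff.2 fun i => by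
    filter_upwards [hrun.ae_oracle_eq hsel hW hWeq (hu0 0).ne' (hadapt 0).2.2.1 i] with ω h
      using h.2
  have hpath : ∀ᵐ ω ∂μ, IsPerturbedPath X φ ψ L η
      (fun t => gaussianSmoothing (expectedObjective F P) (u t))
      (fun τ => averageGradient g τ ω) (fun τ => smoothedGradient Γ P (u τ) (y τ ω))
      (fun τ => x τ ω) (fun τ => y τ ω) (fun τ => z τ ω) xstar (expectedObjective F P xstar)
      (L₀ * R * D) L₀ R := by
    filter_upwards [hg₀] with ω hω
    exact {
      convex := hφ_convex
      strongConvex := hψ_convex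
      nonneg := hψ_nonneg
      z_mem := fun t => hrun.z_mem t ω
      z_min := fun t => hrun.z_min t ω
      y_eq := fun t => hrun.y_eq t ω
      x_succ := fun t => hrun.x_succ t ω
      coeff_mono := fun t => coeff_mono_of_eq hL₀ hub (by positivity) hu hL hη (t + 1)
      coeff_nonneg := fun t => (hκ0 t).le
      eta_pos := hη0
      add_inner_le := fun t w => hsel.gaussianSmoothing_add_inner_le (hu0 t).ne' _ w
      descent := fun t v => by
        rw [hL]
        exact hsel.gaussianSmoothing_add_le (hu0 t) _ v
      antitone := fun t w => gaussianSmoothing_mono hlip hf_convex (hu0 _).le (by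
        rw [hu, hu]
        exact mul_le_mul_of_nonneg_right (theta_succ_le t) hub.le) w
      -- Since √d = D² and u_t = θ_t R / D, the smoothing bias L₀ u_t √d is L₀ R D θ_t.
      le_star := fun t => by
        refine (gaussianSmoothing_le hlip hL₀.le (hu0 t).le xstar).trans_eq ?_
        rw [hu, hDsq]
        field_simp
      lipschitz_zero := fun v w =>
        (le_abs_self _).trans (abs_gaussianSmoothing_sub_le hlip (u 0) v w)
      norm_zero_le := norm_averageGradient_le hm hω
      coeff_one := by
        refine le_add_of_le_of_nonneg ?_ (div_pos (hη0 1) (theta_pos 1)).le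
        rw [hL]
        refine div_le_div_of_nonneg_left hL₀.le (hu0 1) ?_
        rw [hu]
        have h1 := theta_le_one 1
        have h2 : D⁻¹ ≤ 1 := inv_le_one_of_one_le₀ hD1
        calc theta 1 * (R * D⁻¹) ≤ 1 * (R * 1) := by gcongr
          _ = R := by ring
      pos_R := hR
      star_mem := hxstar
      prox_star := hψ_xstar }
  -- The iterate x_T is governed by the estimate with index t = T - 1, so T ≥ 4 becomes t ≥ 3.
  obtain ⟨t, rfl⟩ : ∃ t, T = t + 1 := ⟨T - 1, by omega⟩
  have ht : 3 ≤ t := by omega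
  have hnoise := fun τ => hrun.integral_noise_le hm hsel hW hWeq (hu0 (τ + 1)).ne' (hη0 (τ + 1))
    (hadapt (τ + 1)).2.2.1 (hadapt (τ + 1)).2.1 xstar
  let N : Ω → ℝ := fun ω => ∑ τ ∈ Finset.range t, IsPerturbedPath.noise η
    (fun τ => averageGradient g τ ω) (fun τ => smoothedGradient Γ P (u τ) (y τ ω))
    (fun τ => z τ ω) xstar (τ + 1)
  have hNint : Integrable N μ := integrable_finsetSum _ fun τ _ => (hnoise τ).1
  -- From 1/θ_{τ+1} ≤ τ + 2 and the choice of η, the noise of step τ + 1 has mean at most (L₀ R /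
  -- √m) √(τ + 2) / 2. Each of the t terms is bounded by the value with √(t + 1).
  have hNle : ∫ ω, N ω ∂μ ≤ L₀ * R / √(m : ℝ) * (((t : ℝ) + 1) * √((t : ℝ) + 1) / 2) := by
    rw [integral_finsetSum _ fun τ _ => (hnoise τ).1]
    have hterm : ∀ τ ∈ Finset.range t, ∫ ω, IsPerturbedPath.noise η
        (fun τ => averageGradient g τ ω) (fun τ => smoothedGradient Γ P (u τ) (y τ ω))
        (fun τ => z τ ω) xstar (τ + 1) ∂μ ≤ L₀ * R / √(m : ℝ) * (√((t : ℝ) + 1) / 2) := by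
      intro τ hτ
      refine (hnoise τ).2.trans ?_
      have h1 := one_div_theta_le (τ + 1)
      have hτt : (τ : ℝ) + 1 ≤ t := by exact_mod_cast Finset.mem_range.1 hτ
      push_cast at h1
      have hs0 : 0 < √((τ : ℝ) + 1 + 1) := Real.sqrt_pos.2 (by positivity)
      have hss : √((τ : ℝ) + 1 + 1) * √((τ : ℝ) + 1 + 1) = (τ : ℝ) + 1 + 1 :=
        Real.mul_self_sqrt (by positivity)
      have hmm : √(m : ℝ) * √(m : ℝ) = m := Real.mul_self_sqrt hm0.le
      have heq : L₀ ^ 2 / m / (2 * η (τ + 1))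
          = L₀ * R / √(m : ℝ) * (1 / (2 * √((τ : ℝ) + 1 + 1))) := by
        rw [hη, show L₀ ^ 2 / (m : ℝ) = L₀ / √(m : ℝ) * (L₀ / √(m : ℝ)) by
          rw [div_mul_div_comm, hmm, sq]]
        push_cast
        field_simp
      rw [heq]
      have h2 : √((τ : ℝ) + 1 + 1) ≤ √((t : ℝ) + 1) := Real.sqrt_le_sqrt (by linarith)
      calc 1 / theta (τ + 1) * (L₀ * R / √(m : ℝ) * (1 / (2 * √((τ : ℝ) + 1 + 1))))
          ≤ ((τ : ℝ) + 1 + 1) * (L₀ * R / √(m : ℝ) * (1 / (2 * √((τ : ℝ) + 1 + 1)))) := by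
            gcongr
        _ = L₀ * R / √(m : ℝ) * (√((τ : ℝ) + 1 + 1) / 2) := by
            nth_rewrite 1 [← hss]
            field_simp
        _ ≤ L₀ * R / √(m : ℝ) * (√((t : ℝ) + 1) / 2) := by gcongr
    refine (Finset.sum_le_sum hterm).trans ?_
    rw [Finset.sum_const, Finset.card_range, nsmul_eq_mul]
    have : 0 ≤ L₀ * R / √(m : ℝ) * (√((t : ℝ) + 1) / 2) := by positivity
    linarith
  have hA0 : 0 < (1 / theta t) ^ 2 := pow_pos (one_div_theta_pos t) 2
  set A := (1 / theta t) ^ 2 with hA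
  set K := (L (t + 1) + η (t + 1) / theta (t + 1)) * R ^ 2 + 5 * L₀ * R
    + ((t : ℝ) + 1) * (L₀ * R * D) with hK
  have hmain : ∀ᵐ ω ∂μ, expectedObjective F P (x (t + 1) ω) + φ (x (t + 1) ω)
      ≤ expectedObjective F P xstar + φ xstar + K / A + N ω / A := by
    filter_upwards [hpath] with ω hω
    have h1 := hω.objective_le t
    -- Smoothing only increases f, so no bias is paid at x_T.
    have h2 := le_gaussianSmoothing hlip hf_convex (u t) (x (t + 1) ω)
    have h3 : A * (expectedObjective F P (x (t + 1) ω) + φ (x (t + 1) ω))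
        ≤ A * (expectedObjective F P xstar + φ xstar) + K + N ω := by
      have h4 := mul_le_mul_of_nonneg_left h2 hA0.le
      simp only [N, hK]
      linarith
    rw [← mul_le_mul_iff_right₀ hA0]
    refine h3.trans_eq ?_
    field_simp
  obtain ⟨B, hB⟩ := (hadapt (t + 1)).1.2
  have hxm := (hadapt (t + 1)).1.aestronglyMeasurable hW
  have hfint : Integrable (fun ω => expectedObjective F P (x (t + 1) ω)) μ := by
    have hc := continuous_of_abs_sub_le hlip
    refine Integrable.of_bound (hc.comp_aestronglyMeasurable hxm)
      (|expectedObjective F P 0| + L₀ * B) ?_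
    filter_upwards [hB] with ω hω
    have h1 := hlip (x (t + 1) ω) 0
    rw [sub_zero] at h1
    have h2 := abs_sub_abs_le_abs_sub (expectedObjective F P (x (t + 1) ω)) (expectedObjective F P 0)
    have h3 := mul_le_mul_of_nonneg_left hω hL₀.le
    rw [Real.norm_eq_abs]
    linarith
  have hUint : Integrable (fun ω => expectedObjective F P xstar + φ xstar + K / A + N ω / A) μ :=
    (integrable_const _).add (hNint.div_const _)
  have hxmem : ∀ ω, x (t + 1) ω ∈ X := by
    suffices h : ∀ s ω, x s ω ∈ X from h (t + 1)
    intro s ω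
    induction s with
    | zero => rw [hrun.x_zero]; exact hx₀
    | succ s ih =>
      rw [hrun.x_succ]
      exact hX_convex ih (hrun.z_mem s ω) (by linarith [theta_le_one s]) (theta_pos s).le (by ring)
  have hφint : Integrable (fun ω => φ (x (t + 1) ω)) μ := by
    -- The pathwise bound itself, minus the integrable f (x_T), serves as the integrable majorant of
    -- φ (x_T).
    refine integrable_comp_of_lowerSemicontinuousOn hX_closed hφ_closed hxm hxmem hB
      (hUint.sub hfint) ?_
    filter_upwards [hmain] with ω hω
    simp only [Pi.sub_apply]
    linarith
  refine ⟨hfint.add hφint, ?_⟩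
  have hint := integral_mono_ae (hfint.add hφint) hUint hmain
  rw [integral_add (integrable_const _) (hNint.div_const _), integral_div] at hint
  simp only [integral_const, probReal_univ, one_smul, Pi.add_apply] at hint
  have hrate : K + L₀ * R / √(m : ℝ) * (((t : ℝ) + 1) * √((t : ℝ) + 1) / 2)
      ≤ A * (10 * L₀ * R * D / ((t : ℝ) + 1) + 5 * L₀ * R / √(((t : ℝ) + 1) * m)) := by
    have h1 := mul_le_mul_of_nonneg_left (coeff_le_rate ht hD1) (by positivity : 0 ≤ L₀ * R)
    have h2 := mul_le_mul_of_nonneg_left (noise_coeff_le_rate ht)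
      (by positivity : 0 ≤ L₀ * R / √(m : ℝ))
    have hL' : L (t + 1) * R ^ 2 = L₀ * R * (1 / theta (t + 1) * D) := by
      have := (theta_pos (t + 1)).ne'
      rw [hL, hu]
      field_simp
    have hη' : η (t + 1) / theta (t + 1) * R ^ 2
        = L₀ * R / √(m : ℝ) * (1 / theta (t + 1) * √((t : ℝ) + 2)) := by
      have := (theta_pos (t + 1)).ne'
      rw [hη]
      push_cast
      rw [show (t : ℝ) + 1 + 1 = t + 2 by ring]
      field_simp
    have hsqrt : 5 * L₀ * R / √(((t : ℝ) + 1) * m)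
        = L₀ * R / √(m : ℝ) * (5 / √((t : ℝ) + 1)) := by
      rw [Real.sqrt_mul (by positivity)]
      field_simp
    have hdet : 10 * L₀ * R * D / ((t : ℝ) + 1) = L₀ * R * (10 * D / ((t : ℝ) + 1)) := by ring
    rw [hsqrt, hdet, hK, add_mul (L (t + 1)), hL', hη']
    linarith
  have hdiv : K / A + (∫ ω, N ω ∂μ) / A
      ≤ 10 * L₀ * R * D / ((t : ℝ) + 1) + 5 * L₀ * R / √(((t : ℝ) + 1) * m) := by
    rw [← add_div, div_le_iff₀ hA0, mul_comm _ A]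
    linarith
  push_cast
  linarith
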